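/- Let $d,n\ge 1$. Let $\mu$ be a Borel probability measure on $\mathbb{R}^d$ that is absolutely continuous with respect to Lebesgue measure, orthogonal-invariant ($\mu(OB)=\mu(B)$ for every Borel set $B$ and every $d\times d$ orthogonal matrix $O$), and has support equal to the closed unit ball ${\rm cl}(\mathcal{B}_1)$, where $\mathcal{B}_r$ is the open ball of radius $r$ centered at $0$. Let $x_1,\dots,x_n\in\mathbb{R}^d$ be distinct and let $\nu_n=\frac1n\sum_{i=1}^n\delta_{x_i}$. For a finitely discrete probability measure $\nu$, let $Q_\nu$ be the ($\mu$-almost everywhere unique) gradient of a convex function $\mathbb{R}^d\to\mathbb{R}\cup\{\infty\}$ that pushes $\mu$ forward to $\nu$. For $\nu=\sum_{i=1}^n\lambda_i\delta_{x_i}$ and $u$ in the support of $\mu$, the breakdown point is $$\mathrm{BDP}(Q_\nu(u))=\min\Big\{\sum_{i\in I}\lambda_i:\ I\subset\{1,\dots,n\}\text{ such that }\sup_{\tilde\nu}\int_{\mathcal{B}_\delta(u)}\|Q_\nu(y)-Q_{\tilde\nu}(y)\|\,d\mu(y)=\infty\ \text{ for all }\delta>0\Big\},$$ where $\mathcal{B}_\delta(u)$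 is the open ball with center $u$ and radius $\delta$, and the supremum is over all finitely discrete probability measures $\tilde\nu$ whose atoms include $x_i$ and that satisfy $\tilde\nu(\{x_i\})=\lambda_i$, for all $i\notin I$. Let $\lceil t\rceil$ be the usual ceiling of $t$ for $t\neq0$, and let $\lceil 0\rceil=1$. Then the following holds for all $\alpha\in[0,1]$ and all $v\in\mathbb{R}^d$ with $\|v\|=1$. (i) $$\mathrm{BDP}(Q_{\nu_n}(\alpha v))=\big\lceil n\,\mu(\mathcal{B}_1\cap\{u\in\mathbb{R}^d:\alpha\le u_1\le1\})\big\rceil/n.$$ (ii) If $\mu$ is the spherical uniform measure on ${\rm cl}(\mathcal{B}_1)$, that is, the orthogonal-invariant probability measure with $\mu(\mathcal{B}_r)=r$ for all $r\in[0,1]$, then, for $d\ge2$, $$\mathrm{BDP}(Q_{\nu_n}(\alpha v))=\left\lceil\frac{n\,\Gamma(\frac d2)}{\sqrt\pi\,\Gamma(\frac{d-1}2)}\int_\alpha^1\int_x^1 r^{-(d-2)}(r^2-x^2)^{(d-3)/2}\,dr\,dx\right\rceil\Big/n,$$ where the inner integral converges for every $x\in(0,1]$ and is an integrable function of $x$ on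 $(0,1)$; for $d=1$, $\mathrm{BDP}(Q_{\nu_n}(\alpha v))=\lceil n(1-\alpha)/2\rceil/n$. (iii) If $\mu$ is the uniform probability measure on ${\rm cl}(\mathcal{B}_1)$, then $$\mathrm{BDP}(Q_{\nu_n}(\alpha v))=\left\lceil\frac{n\,\Gamma(\frac{d+2}2)}{\sqrt\pi\,\Gamma(\frac{d+1}2)}\int_\alpha^1(1-x^2)^{(d-1)/2}\,dx\right\rceil\Big/n,$$ where $\Gamma$ is the Euler Gamma function. -/

import Mathlib

open MeasureTheory Set
open scoped ENNReal

namespace SemiDiscreteOT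

noncomputable section

/-- Euclidean space of dimension `d`. -/
abbrev E (d : ℕ) : Type := EuclideanSpace ℝ (Fin d)

/-- The finitely discrete measure with atoms `x i` and weights `w i`. -/
def discreteMeasure {d n : ℕ} (w : Fin n → ℝ) (x : Fin n → E d) : Measure (E d) :=
  ∑ i, ENNReal.ofReal (w i) • Measure.dirac (x i)

/-- `Q` is an optimal transport map from `μ` to `ν` in the sense of Brenier and McCann: it pushes
`μ` forward to `ν`, and it is `μ`-almost everywhere the gradient of a convex function `ψ` with
values in `ℝ ∪ {∞}`. The function is given by the convex set `D` on which it is finite and by its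
restriction to `D`; it has a gradient only at points that are interior to `D`. -/
def IsOTMap {d : ℕ} (μ ν : Measure (E d)) (Q : E d → E d) : Prop :=
  Measurable Q ∧ μ.map Q = ν ∧
    ∃ (D : Set (E d)) (ψ : E d → ℝ), ConvexOn ℝ D ψ ∧
      ∀ᵐ u ∂μ, u ∈ interior D ∧ HasGradientAt ψ (Q u) u

open Classical in
/-- The optimal transport map from `μ` to `ν`. For absolutely continuous `μ` it exists and is
unique up to `μ`-null sets; the definition picks a representative. -/
def otMap {d : ℕ} (μ ν : Measure (E d)) : E d → E d :=
  if h : ∃ Q, IsOTMap μ ν Q then h.choose else 0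

/-- `ν'` is a contamination, at the indices in `I`, of the discrete measure with atoms `x i` and
weights `w i`: a finitely discrete probability measure whose atoms include the `x i` with `i ∉ I`
and which gives mass `w i` to each of them. -/
def IsContamination {d n : ℕ} (w : Fin n → ℝ) (x : Fin n → E d) (I : Finset (Fin n))
    (ν' : Measure (E d)) : Prop :=
  (∃ (m : ℕ) (w' : Fin m → ℝ) (x' : Fin m → E d),
      (∀ j, 0 ≤ w' j) ∧ ∑ j, w' j = 1 ∧ ν' = discreteMeasure w' x' ∧
        ∀ i, i ∉ I → x i ∈ Set.range x') ∧
    ∀ i, i ∉ I → ν' {x i} = ENNReal.ofReal (w i)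

/-- Contaminating the atoms with index in `I` breaks down the optimal transport map at `u`. -/
def BreaksDown {d n : ℕ} (μ : Measure (E d)) (w : Fin n → ℝ) (x : Fin n → E d) (u : E d)
    (I : Finset (Fin n)) : Prop :=
  ∀ δ : ℝ, 0 < δ →
    (⨆ (ν' : Measure (E d)) (_ : IsContamination w x I ν'),
      ∫⁻ y in Metric.ball u δ,
        ‖otMap μ (discreteMeasure w x) y - otMap μ ν' y‖ₑ ∂μ) = ⊤

/-- The breakdown point at `u` of the optimal transport map from `μ` to the discrete measure with
atoms `x i` and weights `w i`. The infimum is over a finite set of reals, hence it is a minimum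
as soon as this set is not empty; for the empty set the value is `0`. -/
def breakdownPoint {d n : ℕ} (μ : Measure (E d)) (w : Fin n → ℝ) (x : Fin n → E d)
    (u : E d) : ℝ :=
  sInf {s : ℝ | ∃ I : Finset (Fin n), BreaksDown μ w x u I ∧ s = ∑ i ∈ I, w i}

/-- The breakdown point for the empirical measure of `x 0, …, x (n - 1)`. -/
def empiricalBreakdownPoint {d n : ℕ} (μ : Measure (E d)) (x : Fin n → E d) (u : E d) : ℝ :=
  breakdownPoint μ (fun _ => 1 / (n : ℝ)) x u

/-- The ceiling function, modified so that its value at `0` is `1`. -/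
def modCeil (t : ℝ) : ℤ := if t = 0 then 1 else ⌈t⌉

/-- Invariance of a measure under all orthogonal transformations. -/
def OrthogonalInvariant {d : ℕ} (μ : Measure (E d)) : Prop :=
  ∀ (O : E d ≃ₗᵢ[ℝ] E d) (B : Set (E d)), MeasurableSet B → μ (O '' B) = μ B

/-- The spherical uniform measure on the closed unit ball: the orthogonal-invariant probability
measure that gives mass `r` to the centred open ball of radius `r`, for `0 ≤ r ≤ 1`. -/
def IsSphericalUniform {d : ℕ} (μ : Measure (E d)) : Prop :=
  IsProbabilityMeasure μ ∧ OrthogonalInvariant μ ∧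
    ∀ r ∈ Set.Icc (0 : ℝ) 1, μ (Metric.ball 0 r) = ENNReal.ofReal r

/-- The uniform probability measure on the closed unit ball. -/
def uniformBall (d : ℕ) : Measure (E d) :=
  ProbabilityTheory.cond volume (Metric.closedBall 0 1)

/-- The integrand `r ^ (-(d - 2)) * (r ^ 2 - x ^ 2) ^ ((d - 3) / 2)`. -/
def sphIntegrand (d : ℕ) (x r : ℝ) : ℝ :=
  r ^ (-((d : ℝ) - 2)) * (r ^ 2 - x ^ 2) ^ (((d : ℝ) - 3) / 2)

end

end SemiDiscreteOT

/-! Everything about breakdown follows from monotonicity of gradients of convex functions: `0 ≤ ⟪Q u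
- Q z, u - z⟫` for almost all `u` and `z`. Let `H` be the half-space `α ≤ ⟪v, u⟫`.

Contaminated mass below `μ H` is harmless (`not_breaksDown_of_lt`). If `Q` sent a point `u` near `α
• v` to a huge vector, monotonicity would keep the points sent to uncontaminated atoms out of a
half-space with normal `Q u` at a level slightly above `α`. By orthogonal invariance that half-space
still has more mass than the contamination, so two almost disjoint sets would have total mass above
one.

Contaminated mass at least `μ H` suffices if it is positive (`breaksDown_of_le`). When the
contaminated atoms are translated far along `v`, monotonicity makes their preimage fill the part of
the ball that is extreme in direction `v`, and this part reaches every neighbourhood of `α • v`.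
With weights `1 / n`, a set `I` thus causes breakdown exactly if it is nonempty and `n * μ H ≤
I.card`; this is where `modCeil` comes from.

These estimates hold for every transport map, so uniqueness plays no role. Existence matters only
for the translated atoms and comes from minimizing the dual functional (`exists_isOTMap`).

The explicit formulas compute `μ H` by slicing orthogonally to the first axis. For the spherical
uniform measure, half-space masses depend only on the law of the norm
(`measure_halfSpace_eq_of_map_norm_eq`), so a measure with explicit radial density may replace it.
-/

namespace SemiDiscreteOT

open scoped RealInnerProductSpace
open Filter Topology

/-! ### Monotonicity of gradients of convex functions. -/

section Monotone

variable {F : Type*} [NormedAddCommGroup F] [InnerProductSpace ℝ F] [CompleteSpace F]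

/-- The gradient inequality for a convex function. -/
lemma inner_gradient_le_sub {D : Set F} {f : F → ℝ} (hf : ConvexOn ℝ D f) {u z g : F}
    (hu : u ∈ D) (hz : z ∈ D) (hg : HasGradientAt f g u) : ⟪g, z - u⟫ ≤ f z - f u := by
  have hc := hf.comp_affineMap (AffineMap.lineMap u z : ℝ →ᵃ[ℝ] F)
  have hd : HasDerivAt (f ∘ (AffineMap.lineMap u z : ℝ →ᵃ[ℝ] F)) ⟪g, z - u⟫ 0 := by
    have h1 : HasDerivAt (AffineMap.lineMap u z : ℝ → F) (z - u) 0 :=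
      AffineMap.hasDerivAt_lineMap
    have h2 : HasFDerivAt f (InnerProductSpace.toDual ℝ F g)
        ((AffineMap.lineMap u z : ℝ →ᵃ[ℝ] F) 0) := by
      simpa using hg.hasFDerivAt
    simpa using h2.comp_hasDerivAt (0 : ℝ) h1
  have := hc.le_slope_of_hasDerivAt (x := 0) (y := 1) (by simpa using hu) (by simpa using hz)
    one_pos hd
  simpa [slope_def_field] using this

/-- Gradients of a convex function are monotone. -/
lemma inner_gradient_sub_nonneg {D : Set F} {f : F → ℝ} (hf : ConvexOn ℝ D f) {u z g h : F}
    (hu : u ∈ D) (hz : z ∈ D) (hg : HasGradientAt f g u) (hh : HasGradientAt f h z) :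
    0 ≤ ⟪g - h, u - z⟫ := by
  have h1 := inner_gradient_le_sub hf hu hz hg
  have h2 := inner_gradient_le_sub hf hz hu hh
  have h3 : ⟪g - h, u - z⟫ = -(⟪g, z - u⟫ + ⟪h, u - z⟫) := by
    simp only [inner_sub_left, inner_sub_right]; ring
  rw [h3]; linarith

end Monotone

/-! ### Basic facts on transport maps, discrete measures and null sets. -/

lemma IsOTMap.exists_monotone {d : ℕ} {μ ν : Measure (E d)} {Q : E d → E d}
    (hQ : IsOTMap μ ν Q) :
    ∃ S : Set (E d), (∀ᵐ u ∂μ, u ∈ S) ∧ ∀ u ∈ S, ∀ z ∈ S, 0 ≤ ⟪Q u - Q z, u - z⟫ := by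
  obtain ⟨-, -, D, ψ, hψ, h⟩ := hQ
  exact ⟨_, h, fun u hu z hz => inner_gradient_sub_nonneg hψ (interior_subset hu.1)
    (interior_subset hz.1) hu.2 hz.2⟩

lemma otMap_isOTMap {d : ℕ} {μ ν : Measure (E d)} (h : ∃ Q, IsOTMap μ ν Q) :
    IsOTMap μ ν (otMap μ ν) := by
  rw [otMap, dif_pos h]; exact h.choose_spec

lemma otMap_eq_zero {d : ℕ} {μ ν : Measure (E d)} (h : ¬ ∃ Q, IsOTMap μ ν Q) :
    otMap μ ν = 0 := by
  rw [otMap, dif_neg h]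

lemma discreteMeasure_apply {d n : ℕ} (w : Fin n → ℝ) (x : Fin n → E d) {B : Set (E d)}
    (hB : MeasurableSet B) :
    discreteMeasure w x B = ∑ i, B.indicator (fun _ => ENNReal.ofReal (w i)) (x i) := by
  simp only [discreteMeasure, Measure.coe_finsetSum, Finset.sum_apply, Measure.smul_apply,
    Measure.dirac_apply' _ hB, smul_eq_mul]
  refine Finset.sum_congr rfl fun i _ => ?_
  by_cases h : x i ∈ B <;> simp [h]

lemma discreteMeasure_univ {d n : ℕ} {w : Fin n → ℝ} (hw : ∀ i, 0 ≤ w i) (h1 : ∑ i, w i = 1)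
    (x : Fin n → E d) : discreteMeasure w x univ = 1 := by
  rw [discreteMeasure_apply _ _ MeasurableSet.univ]
  simp only [indicator_univ]
  rw [← ENNReal.ofReal_sum_of_nonneg fun i _ => hw i, h1, ENNReal.ofReal_one]

/-- Affine hyperplanes are null sets. -/
lemma volume_hyperplane {d : ℕ} {a : E d} (ha : a ≠ 0) (c : ℝ) :
    volume {u : E d | ⟪a, u⟫ = c} = 0 := by
  rcases eq_empty_or_nonempty {u : E d | ⟪a, u⟫ = c} with h | ⟨u0, hu0⟩
  · simp [h]
  · let H : AffineSubspace ℝ (E d) := AffineSubspace.mk' u0 (ℝ ∙ a)ᗮ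
    have hH : (H : Set (E d)) = {u : E d | ⟪a, u⟫ = c} := by
      ext u
      have hu0' : ⟪a, u0⟫ = c := hu0
      simp only [H, SetLike.mem_coe, AffineSubspace.mem_mk', vsub_eq_sub, mem_ofPred_eq,
        Submodule.mem_orthogonal_singleton_iff_inner_right, inner_sub_right, hu0', sub_eq_zero]
    rw [← hH]
    -- The affine subspace is proper, since otherwise `a` would be orthogonal to itself.
    refine Measure.addHaar_affineSubspace _ _ fun htop => ha ?_
    have hm : u0 + a ∈ H := by rw [htop]; trivial
    simpa [H, AffineSubspace.mem_mk', Submodule.mem_orthogonal_singleton_iff_inner_right] using hm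

lemma ae_norm_le_one {d : ℕ} {μ : Measure (E d)} (hsupp : μ.support ⊆ Metric.closedBall 0 1) :
    ∀ᵐ u ∂μ, ‖u‖ ≤ 1 := by
  filter_upwards [(Measure.support_mem_ae : μ.support ∈ ae μ)] with u hu
  simpa using hsupp hu

/-- A common bound for the norms of finitely many points. -/
lemma exists_norm_le {d n : ℕ} (x : Fin n → E d) : ∃ M : ℝ, 0 ≤ M ∧ ∀ j, ‖x j‖ ≤ M :=
  ⟨∑ j, ‖x j‖, by positivity, fun j =>
    Finset.single_le_sum (f := fun j => ‖x j‖) (fun _ _ => norm_nonneg _) (Finset.mem_univ j)⟩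

/-! ### Existence of semidiscrete transport maps by duality. -/

section Existence

variable {d n : ℕ} [NeZero n]

/-- The maximum of the affine functions with slopes `x j` and intercepts `g j`. -/
noncomputable def affineMax (x : Fin n → E d) (g : Fin n → ℝ) (u : E d) : ℝ :=
  Finset.univ.sup' Finset.univ_nonempty fun j => ⟪x j, u⟫ + g j

lemma le_affineMax (x : Fin n → E d) (g : Fin n → ℝ) (u : E d) (j : Fin n) :
    ⟪x j, u⟫ + g j ≤ affineMax x g u :=
  Finset.le_sup' (fun j => ⟪x j, u⟫ + g j) (Finset.mem_univ j)

lemma affineMax_le {x : Fin n → E d} {g : Fin n → ℝ} {u : E d} {c : ℝ}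
    (h : ∀ j, ⟪x j, u⟫ + g j ≤ c) : affineMax x g u ≤ c :=
  Finset.sup'_le _ _ fun j _ => h j

lemma exists_affineMax_eq (x : Fin n → E d) (g : Fin n → ℝ) (u : E d) :
    ∃ j, affineMax x g u = ⟪x j, u⟫ + g j := by
  obtain ⟨j, -, hj⟩ := Finset.exists_mem_eq_sup' (Finset.univ_nonempty (α := Fin n))
    fun j => ⟪x j, u⟫ + g j
  exact ⟨j, hj⟩

lemma continuous_affineMax (x : Fin n → E d) (g : Fin n → ℝ) : Continuous (affineMax x g) := by
  unfold affineMax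
  exact Continuous.finset_sup'_apply _ fun j _ => by fun_prop

lemma convexOn_affineMax (x : Fin n → E d) (g : Fin n → ℝ) :
    ConvexOn ℝ univ (affineMax x g) := by
  refine ⟨convex_univ, fun u _ z _ a b ha hb hab => affineMax_le fun j => ?_⟩
  have h1 := mul_le_mul_of_nonneg_left (le_affineMax x g u j) ha
  have h2 := mul_le_mul_of_nonneg_left (le_affineMax x g z j) hb
  simp only [inner_add_right, inner_smul_right, smul_eq_mul]
  have : g j = a * g j + b * g j := by rw [← add_mul, hab, one_mul]
  linarith

lemma affineMax_le_add_norm (x : Fin n → E d) (g h : Fin n → ℝ) (u : E d) :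
    affineMax x g u ≤ affineMax x h u + ‖g - h‖ := by
  refine affineMax_le fun j => ?_
  have h1 := le_affineMax x h u j
  have h2 := (le_abs_self _).trans (norm_le_pi_norm (g - h) j)
  simp only [Pi.sub_apply] at h2
  linarith

lemma affineMax_add_const (x : Fin n → E d) (g : Fin n → ℝ) (c : ℝ) (u : E d) :
    affineMax x (fun j => g j + c) u = affineMax x g u + c := by
  apply le_antisymm
  · exact affineMax_le fun j => by linarith [le_affineMax x g u j]
  · obtain ⟨j, hj⟩ := exists_affineMax_eq x g u
    rw [hj]
    linarith [le_affineMax x (fun j => g j + c) u j]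

variable {μ : Measure (E d)} [IsProbabilityMeasure μ]

lemma integrable_affineMax (hμ : ∀ᵐ u ∂μ, ‖u‖ ≤ 1) (x : Fin n → E d) (g : Fin n → ℝ) :
    Integrable (affineMax x g) μ := by
  obtain ⟨M, hM0, hM⟩ := exists_norm_le x
  refine Integrable.of_bound (continuous_affineMax x g).aestronglyMeasurable (M + ‖g‖) ?_
  filter_upwards [hμ] with u hu
  obtain ⟨j, hj⟩ := exists_affineMax_eq x g u
  rw [hj]
  refine (norm_add_le _ _).trans (add_le_add ?_ (norm_le_pi_norm g j))
  calc ‖⟪x j, u⟫‖ ≤ ‖x j‖ * ‖u‖ := norm_inner_le_norm _ _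
    _ ≤ M * 1 := by gcongr; exact hM j
    _ = M := mul_one M

/-- The dual functional of the semidiscrete transport problem. -/
noncomputable def dualFunctional (μ : Measure (E d)) (w : Fin n → ℝ) (x : Fin n → E d)
    (g : Fin n → ℝ) : ℝ :=
  ∫ u, affineMax x g u ∂μ - ∑ j, w j * g j

lemma continuous_dualFunctional (hμ : ∀ᵐ u ∂μ, ‖u‖ ≤ 1) (w : Fin n → ℝ) (x : Fin n → E d) :
    Continuous (dualFunctional μ w x) := by
  unfold dualFunctional
  refine Continuous.sub ?_ (by fun_prop)
  refine LipschitzWith.continuous (K := 1) (LipschitzWith.of_le_add fun g h => ?_)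
  calc ∫ u, affineMax x g u ∂μ ≤ ∫ u, (affineMax x h u + ‖g - h‖) ∂μ :=
        integral_mono (integrable_affineMax hμ x g)
          ((integrable_affineMax hμ x h).add (integrable_const _))
          fun u => affineMax_le_add_norm x g h u
    _ = _ := by
        rw [integral_add (integrable_affineMax hμ x h) (integrable_const _)]
        simp [dist_eq_norm]

lemma dualFunctional_add_const (hμ : ∀ᵐ u ∂μ, ‖u‖ ≤ 1) {w : Fin n → ℝ} (h1 : ∑ j, w j = 1)
    (x : Fin n → E d) (g : Fin n → ℝ) (c : ℝ) :
    dualFunctional μ w x (fun j => g j + c) = dualFunctional μ w x g := by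
  simp only [dualFunctional, affineMax_add_const]
  rw [integral_add (integrable_affineMax hμ x g) (integrable_const _)]
  simp only [mul_add, Finset.sum_add_distrib, ← Finset.sum_mul, h1]
  simp

/-- Adding a constant to `g` does not change the functional, so only vectors with maximum `0`
matter. Among these the functional is coercive because all weights are positive, and a compact box
contains a minimizer. -/
lemma exists_isMinOn_dualFunctional (hμ : ∀ᵐ u ∂μ, ‖u‖ ≤ 1) {w : Fin n → ℝ}
    (hw : ∀ j, 0 < w j) (h1 : ∑ j, w j = 1) (x : Fin n → E d) :
    ∃ g, ∀ h, dualFunctional μ w x g ≤ dualFunctional μ w x h := by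
  obtain ⟨M, hM0, hM⟩ := exists_norm_le x
  have hin : ∀ᵐ u ∂μ, ∀ j, |⟪x j, u⟫| ≤ M := by
    filter_upwards [hμ] with u hu j
    calc |⟪x j, u⟫| ≤ ‖x j‖ * ‖u‖ := abs_real_inner_le_norm _ _
      _ ≤ M * 1 := by gcongr; exact hM j
      _ = M := mul_one M
  -- `C` is chosen so that `w j * C ≥ 2 * M` for every `j`. A coordinate below `-C` then contributes
  -- at least `2 * M` to the functional, whose integral part is at least `-M`, while the value at
  -- `0` is at most `M`.
  set C : ℝ := ∑ j, 2 * M / w j with hC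
  have hterm : ∀ j, 0 ≤ 2 * M / w j := fun j => div_nonneg (by positivity) (hw j).le
  have hC0 : 0 ≤ C := Finset.sum_nonneg fun j _ => hterm j
  have hwC : ∀ j, 2 * M ≤ w j * C := fun j => by
    have : 2 * M / w j ≤ C := Finset.single_le_sum (f := fun j => 2 * M / w j)
      (fun j _ => hterm j) (Finset.mem_univ j)
    rw [div_le_iff₀ (hw j)] at this
    linarith
  have hK : IsCompact (Icc (fun _ => -C) 0 : Set (Fin n → ℝ)) := isCompact_Icc
  have h0K : (0 : Fin n → ℝ) ∈ Icc (fun _ => -C) (0 : Fin n → ℝ) :=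
    ⟨fun j => by simpa using hC0, le_rfl⟩
  obtain ⟨g, hgK, hg⟩ := hK.exists_isMinOn ⟨0, h0K⟩
    (continuous_dualFunctional hμ w x).continuousOn
  have hF0 : dualFunctional μ w x 0 ≤ M := by
    have : ∫ u, affineMax x 0 u ∂μ ≤ ∫ _, M ∂μ := by
      refine integral_mono_ae (integrable_affineMax hμ x 0) (integrable_const _) ?_
      filter_upwards [hin] with u hu
      exact affineMax_le fun j => by simpa using (le_abs_self _).trans (hu j)
    simpa [dualFunctional] using this
  have key : ∀ h : Fin n → ℝ, (∀ j, h j ≤ 0) → (∃ j, h j = 0) →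
      dualFunctional μ w x g ≤ dualFunctional μ w x h := by
    intro h hle ⟨i, hi⟩
    by_cases hh : ∀ j, -C ≤ h j
    · exact hg ⟨hh, hle⟩
    · push Not at hh
      obtain ⟨j, hj⟩ := hh
      refine (hg h0K).trans (hF0.trans ?_)
      have hint : -M ≤ ∫ u, affineMax x h u ∂μ := by
        have : ∫ _, -M ∂μ ≤ ∫ u, affineMax x h u ∂μ := by
          refine integral_mono_ae (integrable_const _) (integrable_affineMax hμ x h) ?_
          filter_upwards [hin] with u hu
          have := le_affineMax x h u i
          have := (abs_le.1 (hu i)).1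
          rw [hi] at *
          linarith
        simpa using this
      have hsum : ∑ k, w k * h k ≤ w j * h j := by
        rw [← Finset.add_sum_erase _ _ (Finset.mem_univ j)]
        have : ∑ k ∈ Finset.univ.erase j, w k * h k ≤ 0 :=
          Finset.sum_nonpos fun k _ => mul_nonpos_of_nonneg_of_nonpos (hw k).le (hle k)
        linarith
      have := mul_le_mul_of_nonneg_left hj.le (hw j).le
      have := hwC j
      unfold dualFunctional
      linarith
  refine ⟨g, fun h => ?_⟩
  obtain ⟨i, -, hi⟩ := Finset.exists_max_image Finset.univ h Finset.univ_nonempty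
  rw [← dualFunctional_add_const hμ h1 x h (-h i)]
  exact key _ (fun j => by linarith [hi j (Finset.mem_univ j)]) ⟨i, by ring⟩

/-- At a minimizer of the dual functional, each closed Laguerre cell is large enough. -/
lemma le_measure_cell (hμ : ∀ᵐ u ∂μ, ‖u‖ ≤ 1) {w : Fin n → ℝ} {x : Fin n → E d}
    {g : Fin n → ℝ} (hg : ∀ h, dualFunctional μ w x g ≤ dualFunctional μ w x h) (j : Fin n) :
    ENNReal.ofReal (w j) ≤ μ {u | affineMax x g u ≤ ⟪x j, u⟫ + g j} := by
  -- `A s` contains the points where raising `g j` by `s` can change the maximum, and there the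
  -- increase is at most `s`. Minimality against this perturbation bounds the mass of `A s` below;
  -- then `s` tends to `0`.
  let A : ℝ → Set (E d) := fun s => {u | affineMax x g u ≤ ⟪x j, u⟫ + g j + s}
  have hA : ∀ s, MeasurableSet (A s) := fun s =>
    (isClosed_le (continuous_affineMax x g) (by fun_prop)).measurableSet
  have hAs : ∀ s > 0, ENNReal.ofReal (w j) ≤ μ (A s) := by
    intro s hs
    have h1 : ∫ u, affineMax x (Function.update g j (g j + s)) u ∂μ ≤
        ∫ u, affineMax x g u ∂μ + s * μ.real (A s) := by
      have hind : Integrable ((A s).indicator fun _ => s) μ :=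
        (integrable_const s).indicator (hA s)
      calc _ ≤ ∫ u, (affineMax x g u + (A s).indicator (fun _ => s) u) ∂μ := by
            refine integral_mono (integrable_affineMax hμ x _)
              ((integrable_affineMax hμ x g).add hind) fun u => affineMax_le fun i => ?_
            have hi := le_affineMax x g u i
            have h0 : 0 ≤ (A s).indicator (fun _ => s) u := indicator_nonneg (fun _ _ => hs.le) u
            rcases eq_or_ne i j with rfl | hij
            · rw [Function.update_self]
              by_cases hu : u ∈ A s
              · rw [indicator_of_mem hu]; linarith
              · have : ¬ affineMax x g u ≤ ⟪x i, u⟫ + g i + s := hu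
                linarith
            · rw [Function.update_of_ne hij]; linarith
        _ = _ := by
            rw [integral_add (integrable_affineMax hμ x g) hind, integral_indicator (hA s)]
            simp [mul_comm]
    have h2 : ∑ i, w i * Function.update g j (g j + s) i = ∑ i, w i * g i + w j * s := by
      have : ∀ i, w i * Function.update g j (g j + s) i =
          w i * g i + if i = j then w j * s else 0 := by
        intro i
        rcases eq_or_ne i j with rfl | hij
        · simp [mul_add]
        · simp [hij]
      simp [this, Finset.sum_add_distrib]
    have h3 := hg (Function.update g j (g j + s))
    simp only [dualFunctional, h2] at h3
    have h4 : w j * s ≤ μ.real (A s) * s := by linarith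
    exact ENNReal.ofReal_le_of_le_toReal (le_of_mul_le_mul_right h4 hs)
  have hlim := tendsto_measure_biInter_gt (μ := μ) (s := A) (a := 0)
    (fun r _ => (hA r).nullMeasurableSet)
    (fun i k _ hik u hu => by
      have : affineMax x g u ≤ ⟪x j, u⟫ + g j + i := hu
      show affineMax x g u ≤ ⟪x j, u⟫ + g j + k
      linarith)
    ⟨1, one_pos, measure_ne_top _ _⟩
  have hinter : (⋂ r > (0 : ℝ), A r) = {u | affineMax x g u ≤ ⟪x j, u⟫ + g j} := by
    ext u
    simp only [mem_iInter, A, mem_ofPred_eq]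
    exact ⟨fun h => le_of_forall_pos_le_add h, fun h r hr => by linarith⟩
  rw [hinter] at hlim
  exact ge_of_tendsto hlim (by filter_upwards [self_mem_nhdsWithin] with s hs using hAs s hs)

/-- Existence of the optimal transport map to a discrete measure. -/
theorem exists_isOTMap (hac : μ ≪ volume) (hμ : ∀ᵐ u ∂μ, ‖u‖ ≤ 1) {w : Fin n → ℝ}
    (hw : ∀ j, 0 < w j) (h1 : ∑ j, w j = 1) {x : Fin n → E d} (hx : Function.Injective x) :
    ∃ Q, IsOTMap μ (discreteMeasure w x) Q := by
  obtain ⟨g, hg⟩ := exists_isMinOn_dualFunctional hμ hw h1 x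
  let C : Fin n → Set (E d) := fun j => {u | affineMax x g u ≤ ⟪x j, u⟫ + g j}
  let O : Fin n → Set (E d) := fun j => {u | ∀ i, i ≠ j → ⟪x i, u⟫ + g i < ⟪x j, u⟫ + g j}
  have hO : ∀ j, IsOpen (O j) := fun j => by
    have : O j = ⋂ i, {u | i ≠ j → ⟪x i, u⟫ + g i < ⟪x j, u⟫ + g j} := by
      ext u; simp [O]
    rw [this]
    refine isOpen_iInter_of_finite fun i => ?_
    by_cases hij : i = j
    · simp [hij]
    · simp only [ne_eq, hij, not_false_eq_true, forall_const]
      exact isOpen_lt (by fun_prop) (by fun_prop)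
  -- Ties lie on hyperplanes with normal `x i - x j`, nonzero by injectivity, so open and closed
  -- cells agree almost everywhere.
  have htie : ∀ᵐ u ∂μ, ∀ i j, i ≠ j → ⟪x i, u⟫ + g i ≠ ⟪x j, u⟫ + g j := by
    simp only [ae_all_iff]
    intro i j hij
    have h0 := hac (volume_hyperplane (sub_ne_zero.2 (hx.ne hij)) (g j - g i))
    refine measure_mono_null (fun u hu => ?_) h0
    have hu' : ⟪x i, u⟫ + g i = ⟪x j, u⟫ + g j := by simpa using hu
    show ⟪x i - x j, u⟫ = g j - g i
    rw [inner_sub_left]; linarith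
  have hCO : ∀ᵐ u ∂μ, ∀ j, u ∈ C j → u ∈ O j := by
    filter_upwards [htie] with u hu j hj i hij
    exact lt_of_le_of_ne ((le_affineMax x g u i).trans hj) (hu i j hij)
  have hex : ∀ᵐ u ∂μ, ∃ j, u ∈ O j := by
    filter_upwards [hCO] with u hu
    obtain ⟨j, hj⟩ := exists_affineMax_eq x g u
    exact ⟨j, hu j hj.le⟩
  have hdisj : ∀ i j u, u ∈ O i → u ∈ O j → i = j := fun i j u hi hj => by
    by_contra hne
    exact lt_asymm (hi j (Ne.symm hne)) (hj i hne)
  have hle : ∀ j, ENNReal.ofReal (w j) ≤ μ (O j) := fun j =>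
    (le_measure_cell hμ hg j).trans (measure_mono_ae (by filter_upwards [hCO] with u hu using hu j))
  have hsum : ∑ j, μ (O j) ≤ ∑ j, ENNReal.ofReal (w j) := by
    rw [← ENNReal.ofReal_sum_of_nonneg fun i _ => (hw i).le, h1, ENNReal.ofReal_one,
      ← tsum_fintype (L := .unconditional _), ← measure_iUnion
        (fun i j hij => disjoint_left.2 fun u hi hj => hij (hdisj i j u hi hj))
        fun j => (hO j).measurableSet]
    exact prob_le_one
  -- The cells are disjoint and the lower bounds for their masses already add up to one, so each
  -- bound is an equality.
  have hOw : ∀ j, μ (O j) = ENNReal.ofReal (w j) := by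
    have hle' : ∀ j, w j ≤ μ.real (O j) := fun j =>
      (ENNReal.ofReal_le_iff_le_toReal (measure_ne_top _ _)).1 (hle j)
    have hsum' : ∑ j, μ.real (O j) ≤ ∑ j, w j := by
      have := ENNReal.toReal_mono (ENNReal.sum_ne_top.2 fun j _ => ENNReal.ofReal_ne_top) hsum
      rwa [ENNReal.toReal_sum fun j _ => measure_ne_top _ _,
        ENNReal.toReal_sum fun j _ => ENNReal.ofReal_ne_top,
        Finset.sum_congr rfl fun j _ => ENNReal.toReal_ofReal (hw j).le] at this
    intro j
    rw [(((Finset.sum_eq_sum_iff_of_le fun i _ => hle' i).1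
      (le_antisymm (Finset.sum_le_sum fun i _ => hle' i) hsum')) j (Finset.mem_univ j)),
      ofReal_measureReal]
  let Q : E d → E d := fun u => ∑ j, (O j).indicator (fun _ => x j) u
  have hQm : Measurable Q := Finset.measurable_fun_sum _ fun j _ =>
    measurable_const.indicator (hO j).measurableSet
  have hQ : ∀ j u, u ∈ O j → Q u = x j := fun j u hu => by
    simp only [Q]
    rw [Finset.sum_eq_single j, indicator_of_mem hu]
    · intro i _ hij
      exact indicator_of_notMem (fun hi => hij (hdisj i j u hi hu)) _
    · simp
  refine ⟨Q, hQm, ?_, univ, affineMax x g, convexOn_affineMax x g, ?_⟩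
  · ext B hB
    rw [Measure.map_apply hQm hB, discreteMeasure_apply _ _ hB,
      ← lintegral_indicator_one (hQm hB)]
    have hae : ∀ᵐ u ∂μ, (Q ⁻¹' B).indicator (1 : E d → ℝ≥0∞) u =
        ∑ j, (O j).indicator (fun _ => B.indicator (1 : E d → ℝ≥0∞) (x j)) u := by
      filter_upwards [hex] with u ⟨j, hj⟩
      rw [Finset.sum_eq_single j, indicator_of_mem hj]
      · have hm : u ∈ Q ⁻¹' B ↔ x j ∈ B := by rw [mem_preimage, hQ j u hj]
        by_cases h : x j ∈ B
        · rw [indicator_of_mem h, indicator_of_mem (hm.2 h)]; rfl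
        · rw [indicator_of_notMem h, indicator_of_notMem (mt hm.1 h)]
      · intro i _ hij
        exact indicator_of_notMem (fun hi => hij (hdisj i j u hi hj)) _
      · simp
    rw [lintegral_congr_ae hae, lintegral_finsetSum _ fun j _ =>
      measurable_const.indicator (hO j).measurableSet]
    refine Finset.sum_congr rfl fun j _ => ?_
    rw [lintegral_indicator_const (hO j).measurableSet, hOw j]
    by_cases h : x j ∈ B <;> simp [h]
  · filter_upwards [hex] with u ⟨j, hj⟩
    refine ⟨by simp, ?_⟩
    rw [hQ j u hj]
    -- On the open cell `O j` the maximum coincides with its `j`-th affine function.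
    have h2 : HasGradientAt (fun z : E d => ⟪x j, z⟫ + g j) (x j) u := by
      rw [hasGradientAt_iff_hasFDerivAt]
      exact ((InnerProductSpace.toDual ℝ (E d) (x j)).hasFDerivAt (x := u)).add_const (g j)
    refine h2.congr_of_eventuallyEq ?_
    filter_upwards [(hO j).mem_nhds hj] with z hz
    refine le_antisymm (affineMax_le fun i => ?_) (le_affineMax x g z j)
    rcases eq_or_ne i j with rfl | hij
    · exact le_rfl
    · exact (hz i hij).le

end Existence

/-! ### Masses of half-spaces. -/

section HalfSpace

variable {d : ℕ} {μ : Measure (E d)}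

lemma OrthogonalInvariant.measurePreserving (hinv : OrthogonalInvariant μ)
    (O : E d ≃ₗᵢ[ℝ] E d) : MeasurePreserving O μ μ := by
  refine ⟨O.continuous.measurable, ?_⟩
  ext B hB
  rw [Measure.map_apply O.continuous.measurable hB, ← hinv O _ (O.continuous.measurable hB),
    image_preimage_eq _ O.surjective]

/-- The orthogonal group acts transitively on spheres. -/
lemma exists_linearIsometryEquiv_apply_eq {v z : E d} (h : ‖v‖ = ‖z‖) :
    ∃ O : E d ≃ₗᵢ[ℝ] E d, O v = z :=
  ⟨_, Submodule.reflection_sub h⟩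

lemma OrthogonalInvariant.measure_halfSpace_eq (hinv : OrthogonalInvariant μ) {v z : E d}
    (h : ‖v‖ = ‖z‖) (c : ℝ) : μ {u | c ≤ ⟪v, u⟫} = μ {u | c ≤ ⟪z, u⟫} := by
  obtain ⟨O, rfl⟩ := exists_linearIsometryEquiv_apply_eq h
  symm
  rw [← (hinv.measurePreserving O).measure_preimage
    (measurableSet_le (by fun_prop) (by fun_prop)).nullMeasurableSet]
  simp only [preimage_ofPred_eq, O.inner_map_map]

lemma measure_lt_inner_eq (hac : μ ≪ volume) {v : E d} (hv : ‖v‖ = 1) (c : ℝ) :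
    μ {u | c < ⟪v, u⟫} = μ {u | c ≤ ⟪v, u⟫} := by
  refine measure_congr ?_
  have h0 : ∀ᵐ u ∂μ, ⟪v, u⟫ ≠ c := by
    rw [ae_iff]
    simpa using hac (volume_hyperplane (a := v) (by rintro rfl; simp at hv) c)
  filter_upwards [h0] with u hu
  exact propext ⟨fun h => le_of_lt h, fun h => lt_of_le_of_ne h (Ne.symm hu)⟩

/-- The masses of closed half-spaces depend continuously from the right on the level. -/
lemma exists_lt_measure_halfSpace (hac : μ ≪ volume) {v : E d} (hv : ‖v‖ = 1) {c : ℝ}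
    {r : ℝ≥0∞} (hr : r < μ {u | c ≤ ⟪v, u⟫}) : ∃ η > 0, r < μ {u | c + η ≤ ⟪v, u⟫} := by
  rw [← measure_lt_inner_eq hac hv] at hr
  have hU : {u : E d | c < ⟪v, u⟫} = ⋃ m : ℕ, {u | c + 1 / ((m : ℝ) + 1) ≤ ⟪v, u⟫} := by
    ext u
    simp only [mem_ofPred_eq, mem_iUnion]
    constructor
    · intro h
      obtain ⟨m, hm⟩ := exists_nat_one_div_lt (sub_pos.2 h)
      exact ⟨m, by linarith⟩
    · rintro ⟨m, hm⟩
      have : (0 : ℝ) < 1 / ((m : ℝ) + 1) := by positivity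
      linarith
  have hmono : Monotone fun m : ℕ => {u : E d | c + 1 / ((m : ℝ) + 1) ≤ ⟪v, u⟫} := by
    intro m k hmk u hu
    have h1 : (1 : ℝ) / ((k : ℝ) + 1) ≤ 1 / ((m : ℝ) + 1) := one_div_le_one_div_of_le
      (by positivity) (by exact_mod_cast Nat.succ_le_succ hmk)
    have h2 : c + 1 / ((m : ℝ) + 1) ≤ ⟪v, u⟫ := hu
    show c + 1 / ((k : ℝ) + 1) ≤ ⟪v, u⟫
    linarith
  rw [hU] at hr
  obtain ⟨m, hm⟩ := ((tendsto_measure_iUnion_atTop hmono).eventually (lt_mem_nhds hr)).exists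
  exact ⟨1 / ((m : ℝ) + 1), by positivity, hm⟩

lemma exists_measure_halfSpace_lt [IsProbabilityMeasure μ] (hac : μ ≪ volume)
    (hμ : ∀ᵐ u ∂μ, ‖u‖ ≤ 1) {v : E d} (hv : ‖v‖ = 1) {r : ℝ≥0∞} (hr : 0 < r) :
    ∃ γ < 1, μ {u | γ ≤ ⟪v, u⟫} < r := by
  have h0 : μ {u | 1 ≤ ⟪v, u⟫} = 0 := by
    rw [← measure_lt_inner_eq hac hv, ← nonpos_iff_eq_zero, ← measure_empty (μ := μ)]
    refine measure_mono_ae ?_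
    filter_upwards [hμ] with u hu hlt
    have h1 : ⟪v, u⟫ ≤ ‖v‖ * ‖u‖ := real_inner_le_norm v u
    rw [hv, one_mul] at h1
    exact absurd (lt_of_lt_of_le hlt (h1.trans hu)) (lt_irrefl _)
  have hI : {u : E d | 1 ≤ ⟪v, u⟫} = ⋂ m : ℕ, {u | 1 - 1 / ((m : ℝ) + 1) ≤ ⟪v, u⟫} := by
    ext u
    simp only [mem_ofPred_eq, mem_iInter]
    constructor
    · intro h m
      have : (0 : ℝ) < 1 / ((m : ℝ) + 1) := by positivity
      linarith
    · intro h
      by_contra! hlt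
      obtain ⟨m, hm⟩ := exists_nat_one_div_lt (sub_pos.2 hlt)
      linarith [h m]
  have hanti : Antitone fun m : ℕ => {u : E d | 1 - 1 / ((m : ℝ) + 1) ≤ ⟪v, u⟫} := by
    intro m k hmk u hu
    have h1 : (1 : ℝ) / ((k : ℝ) + 1) ≤ 1 / ((m : ℝ) + 1) := one_div_le_one_div_of_le
      (by positivity) (by exact_mod_cast Nat.succ_le_succ hmk)
    have h2 : 1 - 1 / ((k : ℝ) + 1) ≤ ⟪v, u⟫ := hu
    show 1 - 1 / ((m : ℝ) + 1) ≤ ⟪v, u⟫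
    linarith
  have hlim := tendsto_measure_iInter_atTop (μ := μ)
    (fun m => (measurableSet_le measurable_const (by fun_prop)).nullMeasurableSet)
    hanti ⟨0, measure_ne_top _ _⟩
  rw [← hI, h0] at hlim
  obtain ⟨m, hm⟩ := (hlim.eventually (gt_mem_nhds hr)).exists
  exact ⟨1 - 1 / ((m : ℝ) + 1), by linarith [show (0 : ℝ) < 1 / ((m : ℝ) + 1) by positivity], hm⟩

lemma measure_pos_of_mem_closedBall (hsupp : μ.support = Metric.closedBall 0 1) {U : Set (E d)}
    (hU : IsOpen U) {z : E d} (hz : z ∈ U) (h1 : ‖z‖ ≤ 1) : 0 < μ U := by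
  have : z ∈ μ.support := by rw [hsupp]; simpa using h1
  exact (Measure.mem_support_iff_forall z).1 this U (hU.mem_nhds hz)

/-- Levels that separate a half-space of mass less than `r` from a part of the ball of radius `δ`
around `α • v` with positive mass. -/
lemma exists_separating_levels [IsProbabilityMeasure μ] (hac : μ ≪ volume)
    (hsupp : μ.support = Metric.closedBall 0 1) {v : E d} (hv : ‖v‖ = 1) {α : ℝ}
    (hα : α ∈ Icc (0 : ℝ) 1) {r : ℝ≥0∞} (hr : 0 < r) (hle : μ {u | α ≤ ⟪v, u⟫} ≤ r) {δ : ℝ}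
    (hδ : 0 < δ) : ∃ γ γ' : ℝ, γ < γ' ∧ μ {u | γ ≤ ⟪v, u⟫} < r ∧
      0 < μ (Metric.ball (α • v) δ ∩ {u | γ' < ⟪v, u⟫}) := by
  have hopen : ∀ c : ℝ, IsOpen {u : E d | c < ⟪v, u⟫} := fun c =>
    isOpen_lt continuous_const (by fun_prop)
  have hvv : ∀ c : ℝ, ⟪v, c • v⟫ = c := fun c => by
    rw [inner_smul_right, real_inner_self_eq_norm_sq, hv]; ring
  rcases hα.2.lt_or_eq with h1 | rfl
  -- The strip of levels between `α` and `α + 2 * ε` contains `(α + ε) • v` and has positive mass,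
  -- which makes the inequality strict at level `α + 2 * ε`. The point `(α + 3 * ε) • v` lies beyond
  -- the second level and within `δ` of `α • v`.
  · set ε := min δ (1 - α) / 4 with hε
    have hm : 0 < min δ (1 - α) := lt_min hδ (by linarith)
    have hε0 : 0 < ε := by positivity
    have hε1 : 4 * ε ≤ δ := by linarith [min_le_left δ (1 - α)]
    have hε2 : 4 * ε ≤ 1 - α := by linarith [min_le_right δ (1 - α)]
    refine ⟨α + 2 * ε, α + 2 * ε + ε / 2, by linarith, ?_, ?_⟩
    · refine lt_of_lt_of_le ?_ hle
      have hopen' : IsOpen ({u : E d | α < ⟪v, u⟫} ∩ {u | ⟪v, u⟫ < α + 2 * ε}) :=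
        (hopen α).inter (isOpen_lt (by fun_prop) continuous_const)
      have hpos := measure_pos_of_mem_closedBall hsupp hopen' (z := (α + ε) • v)
        ⟨by simp only [mem_ofPred_eq, hvv]; linarith, by simp only [mem_ofPred_eq, hvv]; linarith⟩
        (by rw [norm_smul, hv, mul_one, Real.norm_eq_abs, abs_le]; constructor <;> linarith [hα.1])
      have hadd : μ {u | α + 2 * ε ≤ ⟪v, u⟫} +
          μ ({u : E d | α < ⟪v, u⟫} ∩ {u | ⟪v, u⟫ < α + 2 * ε}) ≤ μ {u | α ≤ ⟪v, u⟫} := by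
        rw [← measure_union _ hopen'.measurableSet]
        · refine measure_mono ?_
          rintro u (hu | hu)
          · simp only [mem_ofPred_eq] at hu ⊢; linarith
          · have h3 : α < ⟪v, u⟫ := hu.1
            exact h3.le
        · refine disjoint_left.2 fun u hu hu' => ?_
          have h2 : ⟪v, u⟫ < α + 2 * ε := hu'.2
          simp only [mem_ofPred_eq] at hu
          linarith
      exact lt_of_lt_of_le (ENNReal.lt_add_right (measure_ne_top _ _) hpos.ne') hadd
    · refine measure_pos_of_mem_closedBall hsupp (Metric.isOpen_ball.inter (hopen _))
        (z := (α + 3 * ε) • v) ⟨?_, by simp only [mem_ofPred_eq, hvv]; linarith⟩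
        (by rw [norm_smul, hv, mul_one, Real.norm_eq_abs, abs_le]; constructor <;> linarith [hα.1])
      rw [Metric.mem_ball, dist_eq_norm, ← sub_smul, norm_smul, hv, mul_one, Real.norm_eq_abs,
        abs_lt]
      constructor <;> linarith
  -- For `α = 1` there is no room beyond `v`; instead the half-space masses tend to `0` as the level
  -- rises to `1`, so some level below `1` works.
  · obtain ⟨γ, hγ, hlt⟩ := exists_measure_halfSpace_lt hac (ae_norm_le_one hsupp.le) hv hr
    refine ⟨γ, (γ + 1) / 2, by linarith, hlt, ?_⟩
    refine measure_pos_of_mem_closedBall hsupp (Metric.isOpen_ball.inter (hopen _))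
      (z := (1 : ℝ) • v) ⟨by simpa using hδ, by simp only [mem_ofPred_eq, hvv]; linarith⟩
      (by simp [hv])

end HalfSpace

/-! ### Breakdown and contaminated mass. -/

section Breakdown

variable {d n : ℕ} {μ : Measure (E d)}

lemma IsOTMap.ae_mem {ν : Measure (E d)} {Q : E d → E d} (hQ : IsOTMap μ ν Q) {p : E d → Prop}
    (hp : ∀ᵐ z ∂ν, p z) : ∀ᵐ u ∂μ, p (Q u) := by
  rw [← hQ.2.1] at hp
  exact ae_of_ae_map hQ.1.aemeasurable hp

lemma ae_discreteMeasure_mem_range (w : Fin n → ℝ) (x : Fin n → E d) :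
    ∀ᵐ z ∂(discreteMeasure w x), z ∈ range x := by
  rw [ae_iff, discreteMeasure_apply]
  · refine Finset.sum_eq_zero fun i _ => indicator_of_notMem ?_ _
    simp
  · exact (finite_range x).measurableSet.compl

lemma ae_norm_otMap_le (w : Fin n → ℝ) {x : Fin n → E d} {M : ℝ} (hM0 : 0 ≤ M)
    (hM : ∀ i, ‖x i‖ ≤ M) : ∀ᵐ u ∂μ, ‖otMap μ (discreteMeasure w x) u‖ ≤ M := by
  by_cases h : ∃ Q, IsOTMap μ (discreteMeasure w x) Q
  · filter_upwards [(otMap_isOTMap h).ae_mem (ae_discreteMeasure_mem_range w x)] with u ⟨i, hi⟩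
    rw [← hi]; exact hM i
  · simp [otMap_eq_zero h, hM0]

/-- The only contamination at no index is the original measure. -/
lemma IsContamination.eq_of_empty {w : Fin n → ℝ} (hw : ∀ i, 0 ≤ w i) (h1 : ∑ i, w i = 1)
    {x : Fin n → E d} (hx : Function.Injective x) {ν : Measure (E d)}
    (h : IsContamination w x ∅ ν) : ν = discreteMeasure w x := by
  obtain ⟨⟨m, w', x', hw', h1', hν, -⟩, hmass⟩ := h
  have huniv : ν univ = 1 := by rw [hν]; exact discreteMeasure_univ hw' h1' x'
  have hfin : IsProbabilityMeasure ν := ⟨huniv⟩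
  have hsplit : ∀ B : Set (E d), MeasurableSet B →
      ν (B ∩ range x) = discreteMeasure w x B := by
    intro B hB
    have hU : B ∩ range x = ⋃ i, B ∩ {x i} := by
      rw [← inter_iUnion, iUnion_singleton_eq_range]
    rw [hU, measure_iUnion _ fun i => hB.inter (measurableSet_singleton _), tsum_fintype,
      discreteMeasure_apply _ _ hB]
    · refine Finset.sum_congr rfl fun i _ => ?_
      by_cases hi : x i ∈ B
      · rw [indicator_of_mem hi, inter_eq_right.2 (singleton_subset_iff.2 hi)]
        exact hmass i (Finset.notMem_empty i)
      · rw [indicator_of_notMem hi, inter_singleton_eq_empty.2 hi, measure_empty]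
    · intro i j hij
      refine disjoint_left.2 fun z hi hj => hij (hx ?_)
      rw [← show z = x i from hi.2, ← show z = x j from hj.2]
  have hr : ν (range x)ᶜ = 0 := by
    rw [prob_compl_eq_zero_iff (finite_range x).measurableSet, ← univ_inter (range x),
      hsplit _ MeasurableSet.univ, discreteMeasure_univ hw h1]
  ext B hB
  rw [← hsplit B hB, measure_inter_conull' (measure_mono_null _ hr)]
  exact fun z hz => hz.2

/-- This forces at least one contaminated atom even when the half-space is null, as for `α = 1`, and
explains the value `1` of `modCeil` at `0`. -/
lemma not_breaksDown_empty {w : Fin n → ℝ} (hw : ∀ i, 0 ≤ w i) (h1 : ∑ i, w i = 1)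
    {x : Fin n → E d} (hx : Function.Injective x) (u : E d) : ¬ BreaksDown μ w x u ∅ := by
  intro h
  have h' := h 1 one_pos
  have h0 : (⨆ (ν' : Measure (E d)) (_ : IsContamination w x ∅ ν'),
      ∫⁻ y in Metric.ball u 1,
        ‖otMap μ (discreteMeasure w x) y - otMap μ ν' y‖ₑ ∂μ) ≤ 0 := by
    refine iSup₂_le fun ν' hν' => ?_
    rw [hν'.eq_of_empty hw h1 hx]
    simp
  rw [h'] at h0
  simp at h0

/-- The optimal transport map to a measure that has its atoms with index in `I` far away in
direction `v` is large on half-spaces of smaller mass. -/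
lemma ae_le_norm_of_far {w : Fin n → ℝ} (hw : ∀ i, 0 ≤ w i)
    (hμ : ∀ᵐ u ∂μ, ‖u‖ ≤ 1) {x x' : Fin n → E d} {M : ℝ} (hM : ∀ i, ‖x i‖ ≤ M)
    {v : E d} (hv : ‖v‖ = 1) {γ γ' : ℝ} {I : Finset (Fin n)}
    (hI : μ {u | γ ≤ ⟪v, u⟫} < ENNReal.ofReal (∑ i ∈ I, w i)) {R : ℝ} (hR : 2 * M < R)
    (hR' : 4 * M ≤ R * (γ' - γ)) (hin : ∀ i ∈ I, x' i = x i + R • v)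
    (hout : ∀ i ∉ I, x' i = x i) {Q : E d → E d} (hQ : IsOTMap μ (discreteMeasure w x') Q) :
    ∀ᵐ u ∂μ, γ' < ⟪v, u⟫ → R - M ≤ ‖Q u‖ := by
  obtain ⟨S, hS, hmono⟩ := hQ.exists_monotone
  have hrange := hQ.ae_mem (ae_discreteMeasure_mem_range w x')
  have hbig : ∀ i ∈ I, R - M ≤ ‖x' i‖ := fun i hi => by
    rw [hin i hi]
    have h1 : ‖R • v‖ ≤ ‖x i + R • v‖ + ‖x i‖ := by
      simpa using norm_sub_le (x i + R • v) (x i)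
    rw [norm_smul, hv, mul_one, Real.norm_eq_abs] at h1
    linarith [le_abs_self R, hM i]
  have hB : MeasurableSet {z : E d | M < ‖z‖} := measurableSet_lt measurable_const measurable_norm
  have hmass : ENNReal.ofReal (∑ i ∈ I, w i) ≤ μ (Q ⁻¹' {z | M < ‖z‖}) := by
    rw [← Measure.map_apply hQ.1 hB, hQ.2.1, discreteMeasure_apply _ _ hB,
      ENNReal.ofReal_sum_of_nonneg fun i _ => hw i]
    refine le_trans (Finset.sum_le_sum fun i hi => ?_)
      (Finset.sum_le_sum_of_subset (Finset.subset_univ I))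
    have hi' : x' i ∈ {z : E d | M < ‖z‖} := by
      have := hbig i hi
      show M < ‖x' i‖
      linarith
    rw [indicator_of_mem hi']
  filter_upwards [hS, hμ, hrange] with u hu hu1 ⟨j, hj⟩ hγ
  by_cases hjI : j ∈ I
  · rw [← hj]; exact hbig j hjI
  -- Suppose `u` beyond level `γ'` is sent to an unmoved atom. It is shown that almost every point
  -- sent to a moved atom then lies beyond level `γ`, so that the moved atoms would carry too little
  -- mass.
  exfalso
  refine lt_irrefl _ (lt_of_le_of_lt (hmass.trans (measure_mono_ae ?_)) hI)
  filter_upwards [hS, hμ, hrange] with z hz hz1 ⟨i, hi⟩ hzB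
  have hzB' : M < ‖Q z‖ := hzB
  have hiI : i ∈ I := by
    by_contra hiI
    rw [← hi, hout i hiI] at hzB'
    exact absurd (hM i) (not_le.2 hzB')
  -- Monotonicity bounds `R * (⟪v, u⟫ - ⟪v, z⟫)` by `⟪x i - x j, z - u⟫`, hence by `4 * M`, which is
  -- at most `R * (γ' - γ)`.
  have h4 := hmono z hz u hu
  rw [← hi, ← hj, hin i hiI, hout j hjI, add_sub_right_comm, inner_add_left,
    real_inner_smul_left, inner_sub_right v] at h4
  have h5 : ⟪x i - x j, z - u⟫ ≤ (M + M) * (1 + 1) :=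
    (real_inner_le_norm _ _).trans (mul_le_mul
      ((norm_sub_le _ _).trans (add_le_add (hM i) (hM j)))
      ((norm_sub_le _ _).trans (add_le_add hz1 hu1)) (norm_nonneg _)
      (by linarith [(norm_nonneg _).trans (hM i)]))
  show γ ≤ ⟪v, z⟫
  have hM0 : 0 ≤ M := (norm_nonneg _).trans (hM i)
  have hR0 : 0 < R := by linarith
  have h6 : R * (γ' - γ) < R * (γ' - γ) + R * (⟪v, u⟫ - γ') := by
    have := mul_pos hR0 (sub_pos.2 hγ)
    linarith
  by_contra! hlt
  have h7 : R * (⟪v, z⟫ - γ) < 0 := mul_neg_of_pos_of_neg hR0 (by linarith)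
  linarith

variable [IsProbabilityMeasure μ]

/-- If the uncontaminated mass and the mass of a half-space exceed one together, then optimal
transport maps to contaminated measures are uniformly bounded near points not too close to the
half-space. -/
lemma ae_norm_le_of_isContamination (hinv : OrthogonalInvariant μ) (hμ : ∀ᵐ u ∂μ, ‖u‖ ≤ 1)
    {w : Fin n → ℝ} (hw : ∀ i, 0 ≤ w i) (h1 : ∑ i, w i = 1)
    {x : Fin n → E d} (hx : Function.Injective x) {M : ℝ} (hM : ∀ i, ‖x i‖ ≤ M)
    {v : E d} (hv : ‖v‖ = 1) {α η : ℝ} (hα : 0 ≤ α) (hη : 0 < η) {I : Finset (Fin n)}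
    (hI : ENNReal.ofReal (∑ i ∈ I, w i) < μ {u | α + η ≤ ⟪v, u⟫})
    {ν : Measure (E d)} (hν : IsContamination w x I ν) {Q : E d → E d} (hQ : IsOTMap μ ν Q) :
    ∀ᵐ u ∂μ, u ∈ Metric.ball (α • v) (η / 2) → ‖Q u‖ ≤ 4 * M / η := by
  obtain ⟨S, hS, hmono⟩ := hQ.exists_monotone
  filter_upwards [hS, hμ] with u hu hu1 hball
  by_contra! hlt
  have hM0 : 0 ≤ M := by
    rcases isEmpty_or_nonempty (Fin n) with hn | ⟨⟨i⟩⟩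
    · simp at h1
    · exact (norm_nonneg _).trans (hM i)
  have hy : 0 < ‖Q u‖ := lt_of_le_of_lt (by positivity) hlt
  have hynorm : ‖(‖Q u‖⁻¹ • Q u)‖ = 1 := by
    rw [norm_smul, norm_inv, norm_norm, inv_mul_cancel₀ hy.ne']
  have hu2 : ‖u‖ < α + η / 2 := by
    have h2 : ‖u - α • v‖ < η / 2 := by simpa [dist_eq_norm] using hball
    have h3 : ‖u‖ ≤ ‖u - α • v‖ + ‖α • v‖ := by simpa using norm_add_le (u - α • v) (α • v)
    rw [norm_smul, hv, mul_one, Real.norm_eq_abs, abs_of_nonneg hα] at h3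
    linarith
  -- `T` is the set of uncontaminated atoms, whose masses are prescribed.
  let T : Finset (E d) := Iᶜ.image x
  have hT : ν T = ENNReal.ofReal (∑ i ∈ Iᶜ, w i) := by
    rw [← sum_measure_singleton, Finset.sum_image fun i _ j _ h => hx h,
      ENNReal.ofReal_sum_of_nonneg fun i _ => hw i]
    exact Finset.sum_congr rfl fun i hi => hν.2 i (Finset.mem_compl.1 hi)
  have hTQ : μ (Q ⁻¹' T) = ENNReal.ofReal (∑ i ∈ Iᶜ, w i) := by
    rw [← hT, ← hQ.2.1, Measure.map_apply hQ.1 T.measurableSet]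
  -- The half-space is rotated so that its normal is the direction of `Q u`.
  rw [hinv.measure_halfSpace_eq (hv.trans hynorm.symm)] at hI
  -- For `z` in both sets, `⟪Q u, z - u⟫` exceeds `‖Q u‖ * η / 2 > 2 * M`, while monotonicity bounds
  -- it by `⟪Q z, z - u⟫ ≤ 2 * M` as `Q z` is an uncontaminated atom.
  have hdisj : AEDisjoint μ (Q ⁻¹' T) {z | α + η ≤ ⟪‖Q u‖⁻¹ • Q u, z⟫} := by
    rw [AEDisjoint, ← nonpos_iff_eq_zero, ← measure_empty (μ := μ)]
    refine measure_mono_ae ?_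
    filter_upwards [hS, hμ] with z hz hz1 hmem
    obtain ⟨hzT, hzH⟩ := hmem
    obtain ⟨i, -, hi⟩ := Finset.mem_image.1 (show Q z ∈ T from hzT)
    have h4 := hmono u hu z hz
    have h5 : |⟪Q z, u - z⟫| ≤ M * 2 :=
      (abs_real_inner_le_norm _ _).trans (by
        gcongr
        · rw [← hi]; exact hM i
        · exact (norm_sub_le _ _).trans (by linarith))
    have h6 : ⟪Q u, u⟫ ≤ ‖Q u‖ * ‖u‖ := real_inner_le_norm _ _
    have h7 : ‖Q u‖ * (α + η) ≤ ⟪Q u, z⟫ := by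
      have h8 : α + η ≤ ⟪‖Q u‖⁻¹ • Q u, z⟫ := hzH
      rw [real_inner_smul_left, ← div_eq_inv_mul, le_div_iff₀ hy] at h8
      linarith
    rw [inner_sub_left, inner_sub_right (Q u)] at h4
    rw [div_lt_iff₀ hη] at hlt
    have h9 : ‖Q u‖ * ‖u‖ < ‖Q u‖ * (α + η / 2) := by gcongr
    exfalso
    linarith [(abs_le.1 h5).1]
  have hsum : μ (Q ⁻¹' T) + μ {z | α + η ≤ ⟪‖Q u‖⁻¹ • Q u, z⟫} ≤ 1 := by
    rw [← measure_union₀ (measurableSet_le measurable_const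
      (by fun_prop)).nullMeasurableSet hdisj]
    exact prob_le_one
  have hlt1 : (1 : ℝ≥0∞) < 1 := by
    calc (1 : ℝ≥0∞) = ENNReal.ofReal (∑ i ∈ Iᶜ, w i) + ENNReal.ofReal (∑ i ∈ I, w i) := by
          rw [← ENNReal.ofReal_add (Finset.sum_nonneg fun i _ => hw i)
            (Finset.sum_nonneg fun i _ => hw i), Finset.sum_compl_add_sum, h1, ENNReal.ofReal_one]
      _ < μ (Q ⁻¹' T) + μ {z | α + η ≤ ⟪‖Q u‖⁻¹ • Q u, z⟫} := by
          rw [hTQ]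
          exact ENNReal.add_lt_add_left ENNReal.ofReal_ne_top hI
      _ ≤ 1 := hsum
  exact lt_irrefl _ hlt1

/-- The optimal transport map does not break down at `α • v` if the contaminated mass is less than
that of the half-space beyond `α • v`. -/
theorem not_breaksDown_of_lt (hac : μ ≪ volume) (hinv : OrthogonalInvariant μ)
    (hμ : ∀ᵐ u ∂μ, ‖u‖ ≤ 1) {w : Fin n → ℝ} (hw : ∀ i, 0 ≤ w i) (h1 : ∑ i, w i = 1)
    {x : Fin n → E d} (hx : Function.Injective x)
    {v : E d} (hv : ‖v‖ = 1) {α : ℝ} (hα : 0 ≤ α) {I : Finset (Fin n)}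
    (hI : ENNReal.ofReal (∑ i ∈ I, w i) < μ {u | α ≤ ⟪v, u⟫}) :
    ¬ BreaksDown μ w x (α • v) I := by
  -- The strict inequality survives a small increase of the level; this provides the margin `η` on
  -- which the uniform bound depends.
  obtain ⟨η, hη, hlt⟩ := exists_lt_measure_halfSpace hac hv hI
  obtain ⟨M, hM0, hM⟩ := exists_norm_le x
  intro hB
  have hbound : (⨆ (ν' : Measure (E d)) (_ : IsContamination w x I ν'),
      ∫⁻ y in Metric.ball (α • v) (η / 2),
        ‖otMap μ (discreteMeasure w x) y - otMap μ ν' y‖ₑ ∂μ) ≤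
        ENNReal.ofReal (M + 4 * M / η) := by
    refine iSup₂_le fun ν' hν' => ?_
    have hae : ∀ᵐ y ∂(μ.restrict (Metric.ball (α • v) (η / 2))),
        ‖otMap μ (discreteMeasure w x) y - otMap μ ν' y‖ₑ ≤ ENNReal.ofReal (M + 4 * M / η) := by
      have h2 : ∀ᵐ y ∂(μ.restrict (Metric.ball (α • v) (η / 2))),
          ‖otMap μ ν' y‖ ≤ 4 * M / η := by
        rw [ae_restrict_iff' measurableSet_ball]
        by_cases hex : ∃ Q, IsOTMap μ ν' Q
        · exact ae_norm_le_of_isContamination hinv hμ hw h1 hx hM hv hα hη hlt hν'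
            (otMap_isOTMap hex)
        · refine ae_of_all _ fun y _ => ?_
          rw [otMap_eq_zero hex, Pi.zero_apply, norm_zero]
          positivity
      filter_upwards [h2, ae_restrict_of_ae (ae_norm_otMap_le w hM0 hM)] with y hy1 hy2
      rw [← ofReal_norm]
      exact ENNReal.ofReal_le_ofReal ((norm_sub_le _ _).trans (add_le_add hy2 hy1))
    refine (lintegral_mono_ae hae).trans ?_
    rw [lintegral_const, Measure.restrict_apply_univ]
    exact (mul_le_mul_right prob_le_one _).trans (mul_one _).le
  rw [hB (η / 2) (by positivity)] at hbound
  simp at hbound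

/-- The optimal transport map breaks down at `α • v` if the contaminated mass is at least that of
the half-space beyond `α • v`. -/
theorem breaksDown_of_le (hac : μ ≪ volume)
    (hsupp : μ.support = Metric.closedBall 0 1) {w : Fin n → ℝ} (hw : ∀ i, 0 < w i)
    (h1 : ∑ i, w i = 1) {x : Fin n → E d} (hx : Function.Injective x)
    {v : E d} (hv : ‖v‖ = 1) {α : ℝ} (hα : α ∈ Icc (0 : ℝ) 1) {I : Finset (Fin n)}
    (hIne : I.Nonempty) (hI : μ {u | α ≤ ⟪v, u⟫} ≤ ENNReal.ofReal (∑ i ∈ I, w i)) :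
    BreaksDown μ w x (α • v) I := by
  have hμ := ae_norm_le_one hsupp.le
  have : NeZero n := ⟨fun h => by subst h; exact hIne.choose.elim0⟩
  obtain ⟨M, hM0, hM⟩ := exists_norm_le x
  intro δ hδ
  obtain ⟨γ, γ', hγ, hlt, hpos⟩ := exists_separating_levels hac hsupp hv hα
    (ENNReal.ofReal_pos.2 (Finset.sum_pos (fun i _ => hw i) hIne)) hI hδ
  set P := Metric.ball (α • v) δ ∩ {u | γ' < ⟪v, u⟫} with hP
  have hPm : MeasurableSet P := measurableSet_ball.inter
    (measurableSet_lt measurable_const (by fun_prop))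
  have hp : 0 < μ.real P := ENNReal.toReal_pos hpos.ne' (measure_ne_top _ _)
  refine ENNReal.eq_top_of_forall_nnreal_le fun r => ?_
  -- The first two summands keep moved atoms away from the old ones, the third meets the separation
  -- condition of `ae_le_norm_of_far`, and the last makes the integral over `P` at least `r`.
  set R : ℝ := 2 * M + 1 + 4 * M / (γ' - γ) + r / μ.real P with hR
  have hg : 0 < γ' - γ := sub_pos.2 hγ
  have hR1 : 0 ≤ 4 * M / (γ' - γ) := by positivity
  have hR2 : 0 ≤ r / μ.real P := by positivity
  have hR3 : 2 * M < R := by linarith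
  have hR4 : 4 * M ≤ R * (γ' - γ) := by
    rw [← div_le_iff₀ hg]; linarith
  let x' : Fin n → E d := fun i => if i ∈ I then x i + R • v else x i
  have hin : ∀ i ∈ I, x' i = x i + R • v := fun i hi => if_pos hi
  have hout : ∀ i ∉ I, x' i = x i := fun i hi => if_neg hi
  have hne : ∀ i j, x i + R • v ≠ x j := fun i j h => by
    have h2 : R • v = x j - x i := by rw [← h]; abel
    have h3 : ‖R • v‖ ≤ M + M := by
      rw [h2]; exact (norm_sub_le _ _).trans (add_le_add (hM j) (hM i))
    rw [norm_smul, hv, mul_one, Real.norm_eq_abs] at h3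
    linarith [le_abs_self R]
  have hx' : Function.Injective x' := fun i j hij => by
    by_cases hi : i ∈ I <;> by_cases hj : j ∈ I
    · rw [hin i hi, hin j hj] at hij; exact hx (add_right_cancel hij)
    · rw [hin i hi, hout j hj] at hij; exact absurd hij (hne i j)
    · rw [hout i hi, hin j hj] at hij; exact absurd hij.symm (hne j i)
    · rw [hout i hi, hout j hj] at hij; exact hx hij
  have hcont : IsContamination w x I (discreteMeasure w x') := by
    refine ⟨⟨n, w, x', fun j => (hw j).le, h1, rfl, fun i hi => ⟨i, hout i hi⟩⟩, fun i hi => ?_⟩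
    rw [discreteMeasure_apply _ _ (measurableSet_singleton _), Finset.sum_eq_single i,
      indicator_of_mem (mem_singleton_iff.2 (hout i hi))]
    · intro j _ hji
      refine indicator_of_notMem (fun hj => hji (hx' ?_)) _
      rw [hout i hi]; exact hj
    · simp
  have hQ := otMap_isOTMap (exists_isOTMap hac hμ hw h1 hx')
  refine le_trans ?_ (le_iSup₂ (f := fun (ν' : Measure (E d)) (_ : IsContamination w x I ν') =>
    ∫⁻ y in Metric.ball (α • v) δ, ‖otMap μ (discreteMeasure w x) y - otMap μ ν' y‖ₑ ∂μ)
    (discreteMeasure w x') hcont)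
  calc (r : ℝ≥0∞) ≤ ENNReal.ofReal (R - 2 * M) * μ P := by
        rw [← ofReal_measureReal (μ := μ) (s := P), ← ENNReal.ofReal_mul (by linarith),
          ← ENNReal.ofReal_coe_nnreal]
        refine ENNReal.ofReal_le_ofReal ?_
        rw [← div_le_iff₀ hp]; linarith
    _ = ∫⁻ _ in P, ENNReal.ofReal (R - 2 * M) ∂μ := by
        rw [lintegral_const, Measure.restrict_apply_univ]
    _ ≤ ∫⁻ y in P, ‖otMap μ (discreteMeasure w x) y - otMap μ (discreteMeasure w x') y‖ₑ ∂μ := by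
        refine lintegral_mono_ae ((ae_restrict_iff' hPm).2 ?_)
        filter_upwards [ae_le_norm_of_far (fun i => (hw i).le) hμ hM hv hlt hR3 hR4 hin hout hQ,
          ae_norm_otMap_le w hM0 hM] with y hy1 hy2 hyP
        rw [← ofReal_norm]
        refine ENNReal.ofReal_le_ofReal ?_
        have h2 := hy1 hyP.2
        have h3 := norm_sub_norm_le (otMap μ (discreteMeasure w x') y)
          (otMap μ (discreteMeasure w x) y)
        rw [norm_sub_rev] at h3
        linarith
    _ ≤ _ := lintegral_mono_set inter_subset_left

/-! ### The least number of contaminated atoms. -/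

lemma one_le_modCeil {t : ℝ} (ht : 0 ≤ t) : 1 ≤ modCeil t := by
  unfold modCeil
  split_ifs with h
  · exact le_rfl
  · exact Int.one_le_ceil_iff.2 (lt_of_le_of_ne ht (Ne.symm h))

lemma modCeil_le_iff {t : ℝ} (ht : 0 ≤ t) {k : ℤ} : modCeil t ≤ k ↔ 1 ≤ k ∧ t ≤ k := by
  constructor
  · intro h
    refine ⟨(one_le_modCeil ht).trans h, ?_⟩
    by_cases h0 : t = 0
    · have : (1 : ℤ) ≤ k := (one_le_modCeil ht).trans h
      rw [h0]; exact_mod_cast le_trans zero_le_one this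
    · rw [modCeil, if_neg h0] at h
      exact Int.ceil_le.1 h
  · rintro ⟨h1, h2⟩
    unfold modCeil
    split_ifs
    · exact h1
    · exact Int.ceil_le.2 h2

theorem empiricalBreakdownPoint_eq (hn : 0 < n) (hac : μ ≪ volume)
    (hinv : OrthogonalInvariant μ) (hsupp : μ.support = Metric.closedBall 0 1)
    {x : Fin n → E d} (hx : Function.Injective x) {v : E d} (hv : ‖v‖ = 1) {α : ℝ}
    (hα : α ∈ Icc (0 : ℝ) 1) :
    empiricalBreakdownPoint μ x (α • v) =
      (modCeil (n * μ.real {u | α ≤ ⟪v, u⟫}) : ℝ) / n := by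
  have hn' : (0 : ℝ) < n := by exact_mod_cast hn
  have hw : ∀ _ : Fin n, 0 < 1 / (n : ℝ) := fun _ => by positivity
  have h1 : ∑ _ : Fin n, 1 / (n : ℝ) = 1 := by
    rw [Finset.sum_const, Finset.card_univ, Fintype.card_fin, nsmul_eq_mul]
    field_simp
  have hsum : ∀ I : Finset (Fin n), ∑ _i ∈ I, 1 / (n : ℝ) = I.card / n := fun I => by
    rw [Finset.sum_const, nsmul_eq_mul, mul_one_div]
  set t := μ.real {u | α ≤ ⟪v, u⟫} with ht
  have ht0 : 0 ≤ n * t := by positivity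
  have hle : ∀ I : Finset (Fin n),
      μ {u | α ≤ ⟪v, u⟫} ≤ ENNReal.ofReal (∑ _i ∈ I, 1 / (n : ℝ)) ↔ n * t ≤ I.card := by
    intro I
    rw [ENNReal.le_ofReal_iff_toReal_le (measure_ne_top _ _)
      (Finset.sum_nonneg fun i _ => (hw i).le), hsum, le_div_iff₀ hn', mul_comm]
    rfl
  refine IsLeast.csInf_eq ⟨?_, ?_⟩
  · have hk1 := one_le_modCeil ht0
    have hkn : modCeil (n * t) ≤ n := (modCeil_le_iff ht0).2
      ⟨by exact_mod_cast hn, by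
        have : t ≤ 1 := measureReal_le_one
        push_cast
        nlinarith⟩
    obtain ⟨k, hk⟩ := Int.eq_ofNat_of_zero_le (zero_le_one.trans hk1)
    have hkn' : k ≤ (Finset.univ : Finset (Fin n)).card := by
      rw [Finset.card_univ, Fintype.card_fin]; omega
    obtain ⟨I, -, hI⟩ := Finset.exists_subset_card_eq hkn'
    refine ⟨I, breaksDown_of_le hac hsupp hw h1 hx hv hα ?_ ((hle I).2 ?_), ?_⟩
    · rw [← Finset.card_pos]; omega
    · have := ((modCeil_le_iff ht0 (k := k)).1 hk.le).2
      rw [hI]; exact_mod_cast this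
    · rw [hsum, hI, hk]; simp
  · rintro s ⟨I, hB, rfl⟩
    rw [hsum]
    gcongr
    have : modCeil (n * t) ≤ (I.card : ℤ) := by
      refine (modCeil_le_iff ht0).2 ⟨?_, ?_⟩
      · have hne : I.Nonempty := by
          rw [Finset.nonempty_iff_ne_empty]
          rintro rfl
          exact not_breaksDown_empty (fun i => (hw i).le) h1 hx _ hB
        exact_mod_cast hne.card_pos
      · have : n * t ≤ (I.card : ℝ) := by
          rw [← hle]
          by_contra! hlt
          exact not_breaksDown_of_lt hac hinv (ae_norm_le_one hsupp.le) (fun i => (hw i).le) h1 hx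
            hv hα.1 hlt hB
        exact_mod_cast this
    exact_mod_cast this

end Breakdown

/-! ### Slicing along the first axis and the uniform measure on the ball. -/

section Slicing

variable {m : ℕ}

/-- Splitting off the first coordinate. -/
def splitFirst (m : ℕ) (u : E (m + 1)) : ℝ × E m := (u 0, WithLp.toLp 2 fun i => u i.succ)

lemma measurePreserving_splitFirst :
    MeasurePreserving (splitFirst m) (volume : Measure (E (m + 1))) volume := by
  have h1 := PiLp.volume_preserving_ofLp (Fin (m + 1))
  have h2 := volume_preserving_piFinSuccAbove (fun _ : Fin (m + 1) => ℝ) 0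
  have h3 := (MeasurePreserving.id (volume : Measure ℝ)).prod (PiLp.volume_preserving_toLp (Fin m))
  exact (h3.comp h2).comp h1

lemma norm_eq_sqrt_splitFirst (u : E (m + 1)) :
    ‖u‖ = √((splitFirst m u).1 ^ 2 + ‖(splitFirst m u).2‖ ^ 2) := by
  rw [EuclideanSpace.norm_eq, EuclideanSpace.norm_sq_eq, Fin.sum_univ_succ]
  simp [splitFirst]

lemma lintegral_slice {F : ℝ → ℝ → ℝ≥0∞} (hF : Measurable (Function.uncurry F)) :
    ∫⁻ u : E (m + 1), F (u 0) ‖u‖ = ∫⁻ a : ℝ, ∫⁻ b : E m, F a (√(a ^ 2 + ‖b‖ ^ 2)) := by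
  have hm : Measurable fun p : ℝ × E m => F p.1 (√(p.1 ^ 2 + ‖p.2‖ ^ 2)) :=
    hF.comp (g := Function.uncurry F)
      (f := fun p : ℝ × E m => (p.1, √(p.1 ^ 2 + ‖p.2‖ ^ 2))) (by fun_prop)
  rw [← lintegral_prod _ hm.aemeasurable, ← Measure.volume_eq_prod,
    ← measurePreserving_splitFirst.lintegral_comp hm]
  refine lintegral_congr fun u => ?_
  rw [norm_eq_sqrt_splitFirst u]
  rfl

/-- The volume of the unit ball in dimension `m`. -/
noncomputable def ballVolume (m : ℕ) : ℝ := √Real.pi ^ m / Real.Gamma (m / 2 + 1)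

lemma ballVolume_pos (m : ℕ) : 0 < ballVolume m :=
  div_pos (by positivity) (Real.Gamma_pos_of_pos (by positivity))

lemma volume_unitBall (m : ℕ) :
    volume (Metric.ball (0 : E m) 1) = ENNReal.ofReal (ballVolume m) := by
  rcases Nat.eq_zero_or_pos m with rfl | hm
  · rw [volume_euclideanSpace_eq_dirac, Measure.dirac_apply' _ measurableSet_ball]
    simp [ballVolume]
  · have : Nonempty (Fin m) := ⟨⟨0, hm⟩⟩
    rw [EuclideanSpace.volume_ball]
    simp [ballVolume]

lemma volume_closedBall_eq {r : ℝ} (hr : 0 ≤ r) :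
    volume (Metric.closedBall (0 : E m) r) = ENNReal.ofReal (r ^ m * ballVolume m) := by
  rw [Measure.addHaar_closedBall _ _ hr, volume_unitBall, finrank_euclideanSpace_fin,
    ENNReal.ofReal_mul (by positivity)]

lemma ballVolume_div (m : ℕ) : ballVolume m / ballVolume (m + 1) =
    Real.Gamma (((m + 1 : ℕ) + 2 : ℝ) / 2) /
      (√Real.pi * Real.Gamma (((m + 1 : ℕ) + 1 : ℝ) / 2)) := by
  have h1 : (((m + 1 : ℕ) + 2 : ℝ) / 2) = ((m + 1 : ℕ) : ℝ) / 2 + 1 := by ring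
  have h2 : (((m + 1 : ℕ) + 1 : ℝ) / 2) = (m : ℝ) / 2 + 1 := by push_cast; ring
  rw [h1, h2, ballVolume, ballVolume]
  have h3 : Real.Gamma ((m : ℝ) / 2 + 1) ≠ 0 := (Real.Gamma_pos_of_pos (by positivity)).ne'
  have h4 : Real.Gamma (((m + 1 : ℕ) : ℝ) / 2 + 1) ≠ 0 :=
    (Real.Gamma_pos_of_pos (by positivity)).ne'
  have h5 : √Real.pi ≠ 0 := (Real.sqrt_pos.2 Real.pi_pos).ne'
  field_simp
  rw [pow_succ]

lemma volume_closedBall_inter_halfSpace {α : ℝ} (hα : α ∈ Icc (0 : ℝ) 1) :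
    volume (Metric.closedBall (0 : E (m + 1)) 1 ∩ {u | α ≤ u 0}) =
      ENNReal.ofReal (ballVolume m * ∫ t in α..1, (1 - t ^ 2) ^ ((m : ℝ) / 2)) := by
  have hmeas : MeasurableSet (Metric.closedBall (0 : E (m + 1)) 1 ∩ {u | α ≤ u 0}) :=
    Metric.isClosed_closedBall.measurableSet.inter
      (measurableSet_le measurable_const (by fun_prop))
  let F : ℝ → ℝ → ℝ≥0∞ := fun a r => {p : ℝ × ℝ | α ≤ p.1 ∧ p.2 ≤ 1}.indicator 1 (a, r)
  have hF : Measurable (Function.uncurry F) :=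
    measurable_one.indicator ((measurableSet_le measurable_const measurable_fst).inter
      (measurableSet_le measurable_snd measurable_const))
  have hcont : Continuous fun t : ℝ => (1 - t ^ 2) ^ ((m : ℝ) / 2) :=
    Continuous.rpow_const (by fun_prop) fun _ => Or.inr (by positivity)
  calc volume (Metric.closedBall (0 : E (m + 1)) 1 ∩ {u | α ≤ u 0})
      = ∫⁻ u : E (m + 1), F (u 0) ‖u‖ := by
        rw [← lintegral_indicator_one hmeas]
        refine lintegral_congr fun u => ?_
        simp only [F, indicator, mem_inter_iff, mem_closedBall_zero_iff, mem_ofPred_eq, and_comm]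
        congr
    _ = ∫⁻ a : ℝ, ∫⁻ b : E m, F a (√(a ^ 2 + ‖b‖ ^ 2)) := lintegral_slice hF
    _ = ∫⁻ a : ℝ, (Icc α 1).indicator (fun a =>
          ENNReal.ofReal (ballVolume m * (1 - a ^ 2) ^ ((m : ℝ) / 2))) a := by
        refine lintegral_congr fun a => ?_
        by_cases ha : a ∈ Icc α 1
        -- The slice at height `a` is a ball of radius `√(1 - a ^ 2)` in dimension `m`.
        · have h1 : 0 ≤ 1 - a ^ 2 := by nlinarith [ha.1, ha.2, hα.1]
          have h2 : ∀ b : E m, F a (√(a ^ 2 + ‖b‖ ^ 2)) =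
              (Metric.closedBall (0 : E m) (√(1 - a ^ 2))).indicator 1 b := by
            intro b
            have h3 : √(a ^ 2 + ‖b‖ ^ 2) ≤ 1 ↔ ‖b‖ ≤ √(1 - a ^ 2) := by
              rw [Real.sqrt_le_iff, Real.le_sqrt (norm_nonneg _) h1]
              constructor
              · intro h; linarith [h.2]
              · intro h; exact ⟨zero_le_one, by linarith⟩
            simp only [F, indicator, mem_ofPred_eq, mem_closedBall_zero_iff, h3, ha.1, true_and]
            rfl
          rw [indicator_of_mem ha, lintegral_congr h2,
            lintegral_indicator_one Metric.isClosed_closedBall.measurableSet,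
            volume_closedBall_eq (Real.sqrt_nonneg _), mul_comm, Real.sqrt_eq_rpow,
            ← Real.rpow_natCast, ← Real.rpow_mul h1]
          congr 3
          ring
        · rw [indicator_of_notMem ha, ← lintegral_zero (μ := (volume : Measure (E m)))]
          refine lintegral_congr fun b => indicator_of_notMem (fun h => ha ⟨h.1, ?_⟩) _
          have h3 : √(a ^ 2 + ‖b‖ ^ 2) ≤ 1 := h.2
          rw [Real.sqrt_le_iff] at h3
          nlinarith [sq_nonneg ‖b‖, h3.2]
    _ = _ := by
        rw [lintegral_indicator measurableSet_Icc, ← intervalIntegral.integral_const_mul,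
          intervalIntegral.integral_of_le hα.2, ← integral_Icc_eq_integral_Ioc,
          ofReal_integral_eq_lintegral_ofReal]
        · exact (continuous_const.mul hcont).integrableOn_Icc
        · refine (ae_restrict_iff' measurableSet_Icc).2 (ae_of_all _ fun t ht => ?_)
          have : 0 ≤ 1 - t ^ 2 := by nlinarith [ht.1, ht.2, hα.1]
          exact mul_nonneg (ballVolume_pos m).le (Real.rpow_nonneg this _)

theorem uniformBall_halfSpace {α : ℝ} (hα : α ∈ Icc (0 : ℝ) 1) :
    (uniformBall (m + 1)).real {u | α ≤ u 0} =
      ballVolume m / ballVolume (m + 1) * ∫ t in α..1, (1 - t ^ 2) ^ ((m : ℝ) / 2) := by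
  have hint : 0 ≤ ∫ t in α..1, (1 - t ^ 2) ^ ((m : ℝ) / 2) :=
    intervalIntegral.integral_nonneg hα.2 fun t ht =>
      Real.rpow_nonneg (by nlinarith [ht.1, ht.2, hα.1]) _
  rw [uniformBall, measureReal_def,
    ProbabilityTheory.cond_apply Metric.isClosed_closedBall.measurableSet,
    volume_closedBall_inter_halfSpace hα, volume_closedBall_eq zero_le_one, ENNReal.toReal_mul,
    ENNReal.toReal_inv, ENNReal.toReal_ofReal (mul_nonneg (ballVolume_pos m).le hint),
    ENNReal.toReal_ofReal (by simpa using (ballVolume_pos (m + 1)).le)]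
  ring

end Slicing

/-! ### Radial measures and the spherical uniform measure. -/

section Radial

variable {d m : ℕ}

/-- Integration of radial functions in polar coordinates. -/
lemma lintegral_fun_norm (hd : 0 < d) {f : ℝ → ℝ≥0∞} (hf : Measurable f) :
    ∫⁻ u : E d, f ‖u‖ =
      ENNReal.ofReal (d * ballVolume d) * ∫⁻ y in Ioi (0 : ℝ), ENNReal.ofReal (y ^ (d - 1)) * f y := by
  have hne : Nonempty (Fin d) := ⟨⟨0, hd⟩⟩
  have hnt : Nontrivial (E d) := inferInstance
  have hmp := (volume : Measure (E d)).measurePreserving_homeomorphUnitSphereProd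
  have hfs : Measurable fun y : Ioi (0 : ℝ) => f y := hf.comp measurable_subtype_coe
  have hpow : Measurable fun y : Ioi (0 : ℝ) => ENNReal.ofReal ((y : ℝ) ^ (d - 1)) := by fun_prop
  calc ∫⁻ u : E d, f ‖u‖
      = ∫⁻ u : ({(0 : E d)}ᶜ : Set (E d)), f ‖(u : E d)‖
          ∂((volume : Measure (E d)).comap Subtype.val) := by
        rw [lintegral_subtype_comap (measurableSet_singleton _).compl fun u => f ‖u‖,
          restrict_compl_singleton]
    _ = ∫⁻ p, f p.2 ∂((volume : Measure (E d)).toSphere.prod (.volumeIoiPow (d - 1))) := by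
        rw [finrank_euclideanSpace_fin] at hmp
        have h : Measurable fun p : Metric.sphere (0 : E d) 1 × Ioi (0 : ℝ) => f p.2 :=
          hfs.comp measurable_snd
        rw [← hmp.lintegral_comp h]
        simp
    _ = (volume : Measure (E d)).toSphere univ *
          ∫⁻ y, f y ∂(Measure.volumeIoiPow (d - 1)) := by
        have hsnd : AEMeasurable (fun p : Metric.sphere (0 : E d) 1 × Ioi (0 : ℝ) => f p.2)
            ((volume : Measure (E d)).toSphere.prod (.volumeIoiPow (d - 1))) :=
          (hfs.comp measurable_snd).aemeasurable
        rw [lintegral_prod _ hsnd]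
        simp only [lintegral_const]
        rw [mul_comm]
    _ = _ := by
        rw [Measure.toSphere_apply_univ, volume_unitBall, finrank_euclideanSpace_fin,
          ENNReal.ofReal_mul (by positivity), ENNReal.ofReal_natCast, Measure.volumeIoiPow,
          lintegral_withDensity_eq_lintegral_mul _ hpow hfs]
        congr 1
        exact lintegral_subtype_comap measurableSet_Ioi
          fun y => ENNReal.ofReal (y ^ (d - 1)) * f y

/-- The mass of the half-space with normal `v` averaged over all directions. -/
lemma measure_halfSpace_eq_lintegral {σ μ : Measure (E d)} [IsProbabilityMeasure σ]
    [IsProbabilityMeasure μ] (hσ : OrthogonalInvariant σ) (hμ : OrthogonalInvariant μ)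
    (h0 : σ {0} = 0) {v : E d} (hv : ‖v‖ = 1) (c : ℝ) :
    μ {u | c ≤ ⟪v, u⟫} = ∫⁻ r, σ {z | c ≤ ⟪‖z‖⁻¹ • z, r • v⟫} ∂(μ.map norm) := by
  have hdir : Measurable fun z : E d => ‖z‖⁻¹ • z := measurable_norm.inv.smul measurable_id
  have hinner : Measurable fun p : E d × E d => ⟪‖p.1‖⁻¹ • p.1, p.2⟫ :=
    (hdir.comp measurable_fst).inner measurable_snd
  have hset : MeasurableSet {p : E d × E d | c ≤ ⟪‖p.1‖⁻¹ • p.1, p.2⟫} :=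
    measurableSet_le measurable_const hinner
  -- An isometry takes `‖u‖ • v` to `u` and commutes with normalization, so invariance of `σ` leaves
  -- a dependence on `‖u‖` alone.
  have hrad : ∀ u : E d, σ {z | c ≤ ⟪‖z‖⁻¹ • z, u⟫} = σ {z | c ≤ ⟪‖z‖⁻¹ • z, ‖u‖ • v⟫} := by
    intro u
    have hnorm : ‖‖u‖ • v‖ = ‖u‖ := by rw [norm_smul, hv, mul_one, norm_norm]
    obtain ⟨O, hO⟩ := exists_linearIsometryEquiv_apply_eq hnorm
    have hu : MeasurableSet {z : E d | c ≤ ⟪‖z‖⁻¹ • z, u⟫} :=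
      measurableSet_le measurable_const (hdir.inner measurable_const)
    rw [← (hσ.measurePreserving O).measure_preimage hu.nullMeasurableSet]
    congr 1
    ext z
    have h2 : ⟪‖O z‖⁻¹ • O z, u⟫ = ⟪‖z‖⁻¹ • z, ‖u‖ • v⟫ := by
      rw [O.norm_map, ← map_smul]
      conv_lhs => rw [← hO]
      rw [O.inner_map_map]
    show c ≤ ⟪‖O z‖⁻¹ • O z, u⟫ ↔ c ≤ ⟪‖z‖⁻¹ • z, ‖u‖ • v⟫
    rw [h2]
  have hG : Measurable fun r : ℝ => σ {z | c ≤ ⟪‖z‖⁻¹ • z, r • v⟫} := by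
    have h3 : MeasurableSet {p : ℝ × E d | c ≤ ⟪‖p.2‖⁻¹ • p.2, p.1 • v⟫} :=
      measurableSet_le measurable_const
        ((hdir.comp measurable_snd).inner (measurable_fst.smul_const v))
    exact measurable_measure_prodMk_left h3
  rw [lintegral_map hG measurable_norm]
  -- Invariance of `μ` permits replacing `v` by the direction of `z`, a unit vector for almost all
  -- `z`. After averaging over `z`, exchanging the integrals leaves only the law of the norm.
  calc μ {u | c ≤ ⟪v, u⟫} = ∫⁻ _ : E d, μ {u | c ≤ ⟪v, u⟫} ∂σ := by simp
    _ = ∫⁻ z, μ {u | c ≤ ⟪‖z‖⁻¹ • z, u⟫} ∂σ := by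
        have hae : ∀ᵐ z ∂σ, z ≠ 0 := by rw [ae_iff]; simpa using h0
        refine lintegral_congr_ae ?_
        filter_upwards [hae] with z hz
        refine hμ.measure_halfSpace_eq ?_ c
        rw [hv, norm_smul, norm_inv, norm_norm, inv_mul_cancel₀ (norm_ne_zero_iff.2 hz)]
    _ = (σ.prod μ) {p : E d × E d | c ≤ ⟪‖p.1‖⁻¹ • p.1, p.2⟫} :=
        (Measure.prod_apply hset).symm
    _ = ∫⁻ u, σ {z | c ≤ ⟪‖z‖⁻¹ • z, u⟫} ∂μ := Measure.prod_apply_symm hset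
    _ = ∫⁻ u, σ {z | c ≤ ⟪‖z‖⁻¹ • z, ‖u‖ • v⟫} ∂μ := lintegral_congr hrad

/-- The masses of half-spaces under an orthogonal-invariant measure depend only on the law of the
norm. -/
theorem measure_halfSpace_eq_of_map_norm_eq {μ μ' : Measure (E d)} [IsProbabilityMeasure μ]
    [IsProbabilityMeasure μ'] (hμ : OrthogonalInvariant μ) (hμ' : OrthogonalInvariant μ')
    (h0 : μ {0} = 0) (h : μ.map norm = μ'.map norm) {v : E d} (hv : ‖v‖ = 1) (c : ℝ) :
    μ {u | c ≤ ⟪v, u⟫} = μ' {u | c ≤ ⟪v, u⟫} := by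
  -- Both masses are averaged over the directions of the same measure `μ`.
  rw [measure_halfSpace_eq_lintegral hμ hμ h0 hv, measure_halfSpace_eq_lintegral hμ hμ' h0 hv, h]

lemma IsSphericalUniform.map_norm {μ : Measure (E d)} (hμ : IsSphericalUniform μ) :
    μ.map norm = volume.restrict (Ioc 0 1) := by
  have := hμ.1
  have hmap : IsFiniteMeasure (μ.map norm) := inferInstance
  -- The preimage of `[r, ∞)` under the norm is the complement of a ball, whose mass is prescribed.
  refine Measure.ext_of_Ici _ _ fun r => ?_
  have hball : norm ⁻¹' Ici r = (Metric.ball (0 : E d) r)ᶜ := by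
    ext u; simp
  have h1 : μ (Metric.ball 0 1)ᶜ = 0 := by
    rw [prob_compl_eq_zero_iff measurableSet_ball, hμ.2.2 1 (by simp), ENNReal.ofReal_one]
  rw [Measure.map_apply measurable_norm measurableSet_Ici, hball,
    Measure.restrict_apply measurableSet_Ici]
  rcases le_or_gt r 0 with hr | hr
  · have : Ici r ∩ Ioc 0 1 = Ioc 0 1 := inter_eq_right.2 fun y hy => hr.trans hy.1.le
    rw [this, Metric.ball_eq_empty.2 hr]
    simp
  rcases le_or_gt r 1 with hr1 | hr1
  · have : Ici r ∩ Ioc 0 1 = Icc r 1 := by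
      ext y
      exact ⟨fun h => ⟨h.1, h.2.2⟩, fun h => ⟨h.1, hr.trans_le h.1, h.2⟩⟩
    rw [this, Real.volume_Icc, prob_compl_eq_one_sub measurableSet_ball, hμ.2.2 r ⟨hr.le, hr1⟩,
      ENNReal.ofReal_sub _ hr.le, ENNReal.ofReal_one]
  · have : Ici r ∩ Ioc 0 1 = ∅ := by
      ext y
      simp only [mem_inter_iff, mem_Ici, mem_Ioc, mem_empty_iff_false, iff_false, not_and]
      intro h _
      linarith
    rw [this, measure_empty]
    exact measure_mono_null (compl_subset_compl.2 (Metric.ball_subset_ball hr1.le)) h1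

/-- The radial density of the spherical uniform measure in dimension `m + 1`. -/
noncomputable def sphDensity (m : ℕ) : ℝ → ℝ≥0∞ :=
  (Iic 1).indicator fun r => ENNReal.ofReal ((((m + 1 : ℕ) : ℝ) * ballVolume (m + 1))⁻¹ * (r ^ m)⁻¹)

lemma measurable_sphDensity (m : ℕ) : Measurable (sphDensity m) :=
  Measurable.indicator (by fun_prop) measurableSet_Iic

/-- The measure on `E (m + 1)` with density proportional to `‖u‖ ^ (-m)` on the unit ball. -/
noncomputable def sphMeasure (m : ℕ) : Measure (E (m + 1)) :=
  volume.withDensity fun u => sphDensity m ‖u‖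

lemma orthogonalInvariant_sphMeasure (m : ℕ) : OrthogonalInvariant (sphMeasure m) := by
  intro O B hB
  have hO : MeasurableSet (O '' B) :=
    (O.toHomeomorph.measurableEmbedding.measurableSet_image).2 hB
  rw [sphMeasure, withDensity_apply _ hB, withDensity_apply _ hO,
    ← O.measurePreserving.setLIntegral_comp_emb O.toHomeomorph.measurableEmbedding]
  simp

lemma map_norm_sphMeasure (m : ℕ) : (sphMeasure m).map norm = volume.restrict (Ioc 0 1) := by
  ext A hA
  have hK : 0 < ((m + 1 : ℕ) : ℝ) * ballVolume (m + 1) :=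
    mul_pos (by positivity) (ballVolume_pos _)
  rw [Measure.map_apply measurable_norm hA, sphMeasure, withDensity_apply _ (measurable_norm hA),
    ← lintegral_indicator (measurable_norm hA), Measure.restrict_apply hA]
  have h1 : ∀ u : E (m + 1), (norm ⁻¹' A).indicator (fun u => sphDensity m ‖u‖) u =
      A.indicator (sphDensity m) ‖u‖ := fun u => rfl
  rw [lintegral_congr h1, lintegral_fun_norm (Nat.succ_pos m)
    ((measurable_sphDensity m).indicator hA), ← lintegral_const_mul' _ _ ENNReal.ofReal_ne_top,
    ← lintegral_indicator measurableSet_Ioi,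
    ← lintegral_indicator_one (hA.inter measurableSet_Ioc)]
  refine lintegral_congr fun y => ?_
  by_cases hy0 : 0 < y
  · rw [indicator_of_mem (show y ∈ Ioi (0 : ℝ) from hy0)]
    by_cases hyA : y ∈ A
    · by_cases hy1 : y ≤ 1
      · rw [indicator_of_mem (show y ∈ A ∩ Ioc 0 1 from ⟨hyA, hy0, hy1⟩), indicator_of_mem hyA,
          sphDensity, indicator_of_mem (show y ∈ Iic (1 : ℝ) from hy1), Nat.succ_sub_one,
          ← ENNReal.ofReal_mul (by positivity), ← ENNReal.ofReal_mul hK.le, Pi.one_apply,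
          ← ENNReal.ofReal_one]
        congr 1
        have : y ^ m ≠ 0 := by positivity
        have : ballVolume (m + 1) ≠ 0 := (ballVolume_pos _).ne'
        field_simp
      · rw [indicator_of_notMem (show y ∉ A ∩ Ioc 0 1 from fun h => hy1 h.2.2),
          indicator_of_mem hyA, sphDensity,
          indicator_of_notMem (show y ∉ Iic (1 : ℝ) from hy1), mul_zero, mul_zero]
    · rw [indicator_of_notMem (show y ∉ A ∩ Ioc 0 1 from fun h => hyA h.1),
        indicator_of_notMem hyA, mul_zero, mul_zero]
  · rw [indicator_of_notMem (show y ∉ Ioi (0 : ℝ) from hy0),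
      indicator_of_notMem (show y ∉ A ∩ Ioc 0 1 from fun h => hy0 h.2.1)]

lemma isProbabilityMeasure_sphMeasure (m : ℕ) : IsProbabilityMeasure (sphMeasure m) := by
  refine ⟨?_⟩
  have h := congrArg (fun ν => ν univ) (map_norm_sphMeasure m)
  simpa [Measure.map_apply measurable_norm MeasurableSet.univ] using h

/-- The substitution `r = √(a ^ 2 + y ^ 2)` in the integral of the spherical integrand. -/
lemma lintegral_sphIntegrand (hm : 0 < m) {a : ℝ} (ha : 0 < a) :
    ∫⁻ r in Ioc a 1, ENNReal.ofReal (sphIntegrand (m + 1) a r) =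
      ∫⁻ y in Ioi (0 : ℝ), ENNReal.ofReal (y ^ (m - 1)) *
        (Iic 1).indicator (fun r => ENNReal.ofReal ((r ^ m)⁻¹)) (√(a ^ 2 + y ^ 2)) := by
  have hpos : ∀ y : ℝ, 0 < a ^ 2 + y ^ 2 := fun y => by positivity
  have hderiv : ∀ y ∈ Ioi (0 : ℝ), HasDerivWithinAt (fun y => √(a ^ 2 + y ^ 2))
      (y / √(a ^ 2 + y ^ 2)) (Ioi 0) y := by
    intro y _
    have h1 : HasDerivAt (fun y : ℝ => a ^ 2 + y ^ 2) (2 * y) y := by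
      simpa using (hasDerivAt_pow 2 y).const_add (a ^ 2)
    have h2 := (h1.sqrt (hpos y).ne').hasDerivWithinAt (s := Ioi (0 : ℝ))
    rwa [mul_div_mul_left _ _ two_ne_zero] at h2
  have hinj : InjOn (fun y : ℝ => √(a ^ 2 + y ^ 2)) (Ioi 0) := by
    intro y hy z hz h
    have h1 : a ^ 2 + y ^ 2 = a ^ 2 + z ^ 2 := (Real.sqrt_inj (hpos y).le (hpos z).le).1 h
    exact (pow_left_inj₀ (le_of_lt hy) (le_of_lt hz) two_ne_zero).1 (by linarith)
  have himage : (fun y : ℝ => √(a ^ 2 + y ^ 2)) '' Ioi 0 = Ioi a := by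
    ext r
    constructor
    · rintro ⟨y, hy, rfl⟩
      have hy' : (0 : ℝ) < y := hy
      exact Real.lt_sqrt_of_sq_lt (by nlinarith)
    · intro hr
      have hr' : a < r := hr
      refine ⟨√(r ^ 2 - a ^ 2), Real.sqrt_pos.2 (by nlinarith), ?_⟩
      simp only
      rw [Real.sq_sqrt (by nlinarith), add_sub_cancel, Real.sqrt_sq (by linarith)]
  have hioc : Ioc a 1 = Iic 1 ∩ Ioi a := by
    ext r; exact and_comm
  rw [hioc, ← Measure.restrict_restrict measurableSet_Iic, ← lintegral_indicator measurableSet_Iic,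
    ← himage, lintegral_image_eq_lintegral_abs_deriv_mul measurableSet_Ioi hderiv hinj]
  refine setLIntegral_congr_fun measurableSet_Ioi fun y hy => ?_
  have hy' : (0 : ℝ) < y := hy
  have hr : 0 < √(a ^ 2 + y ^ 2) := Real.sqrt_pos.2 (hpos y)
  by_cases h1 : √(a ^ 2 + y ^ 2) ∈ Iic (1 : ℝ)
  · rw [indicator_of_mem h1, indicator_of_mem h1, ← ENNReal.ofReal_mul (abs_nonneg _),
      ← ENNReal.ofReal_mul (by positivity), abs_of_pos (div_pos hy' hr)]
    congr 1
    set r := √(a ^ 2 + y ^ 2) with hrdef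
    have hr2 : r ^ 2 - a ^ 2 = y ^ 2 := by rw [hrdef, Real.sq_sqrt (hpos y).le]; ring
    -- With `m = k + 1` the exponent of `r` is `-k`, and that of `y` is `k - 1`, negative for `k =
    -- 0`; the factor `y / r` from the derivative then gives `y ^ k` and `r ^ (-(k + 1))`.
    obtain ⟨k, rfl⟩ := Nat.exists_eq_succ_of_ne_zero hm.ne'
    rw [sphIntegrand, hr2, ← Real.rpow_natCast y 2, ← Real.rpow_mul hy'.le,
      show -((((k.succ + 1 : ℕ) : ℝ)) - 2) = -(k : ℝ) by push_cast; ring,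
      show ((2 : ℕ) : ℝ) * ((((k.succ + 1 : ℕ) : ℝ) - 3) / 2) = (k : ℝ) - 1 by push_cast; ring,
      Real.rpow_neg hr.le, Real.rpow_natCast, Real.rpow_sub_one hy'.ne', Real.rpow_natCast,
      Nat.succ_sub_one, pow_succ]
    field_simp
  · rw [indicator_of_notMem h1, indicator_of_notMem h1, mul_zero, mul_zero]

/-- The ratio of the surface areas of the unit spheres in dimensions `m` and `m + 1`. -/
noncomputable def sphConst (m : ℕ) : ℝ :=
  m * ballVolume m / (((m + 1 : ℕ) : ℝ) * ballVolume (m + 1))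

lemma sphConst_pos (hm : 0 < m) : 0 < sphConst m :=
  div_pos (mul_pos (by exact_mod_cast hm) (ballVolume_pos _))
    (mul_pos (by positivity) (ballVolume_pos _))

lemma sphConst_eq (hm : 0 < m) : sphConst m = Real.Gamma (((m + 1 : ℕ) : ℝ) / 2) /
    (√Real.pi * Real.Gamma ((((m + 1 : ℕ) : ℝ) - 1) / 2)) := by
  have hm' : (0 : ℝ) < m := by exact_mod_cast hm
  rw [show (((m + 1 : ℕ) : ℝ) - 1) / 2 = (m : ℝ) / 2 by push_cast; ring, sphConst, ballVolume,
    ballVolume, Real.Gamma_add_one (by positivity), Real.Gamma_add_one (by positivity)]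
  have h1 : Real.Gamma ((m : ℝ) / 2) ≠ 0 := (Real.Gamma_pos_of_pos (by positivity)).ne'
  have h2 : Real.Gamma (((m + 1 : ℕ) : ℝ) / 2) ≠ 0 := (Real.Gamma_pos_of_pos (by positivity)).ne'
  have h3 : √Real.pi ≠ 0 := (Real.sqrt_pos.2 Real.pi_pos).ne'
  have h4 : ((m + 1 : ℕ) : ℝ) ≠ 0 := by positivity
  rw [pow_succ]
  field_simp

/-- Each slice carries a radial density in dimension `m`. Polar coordinates there, followed by `r =
√(a ^ 2 + y ^ 2)`, give the inner integral, and the two normalizations combine to `sphConst m`. -/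
lemma sphMeasure_halfSpace (hm : 0 < m) {α : ℝ} (hα : 0 ≤ α) :
    sphMeasure m {u | α ≤ u 0} = ENNReal.ofReal (sphConst m) *
      ∫⁻ a in Ioc α 1, ∫⁻ r in Ioc a 1, ENNReal.ofReal (sphIntegrand (m + 1) a r) := by
  have hmeas : MeasurableSet {u : E (m + 1) | α ≤ u 0} :=
    measurableSet_le measurable_const (by fun_prop)
  let F : ℝ → ℝ → ℝ≥0∞ := fun a r => (Ici α).indicator (fun _ => sphDensity m r) a
  have hF : Measurable (Function.uncurry F) := by
    have : Function.uncurry F =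
        (Prod.fst ⁻¹' Ici α).indicator fun p : ℝ × ℝ => sphDensity m p.2 := by
      ext p; rfl
    rw [this]
    exact ((measurable_sphDensity m).comp measurable_snd).indicator
      (measurable_fst measurableSet_Ici)
  have hslice : sphMeasure m {u | α ≤ u 0} =
      ∫⁻ a : ℝ, ∫⁻ b : E m, F a (√(a ^ 2 + ‖b‖ ^ 2)) := by
    rw [← lintegral_slice hF, sphMeasure, withDensity_apply _ hmeas, ← lintegral_indicator hmeas]
    rfl
  have hinner : ∀ a : ℝ, 0 < a → ∫⁻ b : E m, sphDensity m (√(a ^ 2 + ‖b‖ ^ 2)) =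
      ENNReal.ofReal (sphConst m) *
        ∫⁻ r in Ioc a 1, ENNReal.ofReal (sphIntegrand (m + 1) a r) := by
    intro a ha
    rw [lintegral_fun_norm hm (f := fun y => sphDensity m (√(a ^ 2 + y ^ 2)))
      ((measurable_sphDensity m).comp (by fun_prop)), lintegral_sphIntegrand hm ha,
      ← lintegral_const_mul' _ _ ENNReal.ofReal_ne_top,
      ← lintegral_const_mul' _ _ ENNReal.ofReal_ne_top]
    refine setLIntegral_congr_fun measurableSet_Ioi fun y hy => ?_
    have hy' : (0 : ℝ) < y := hy
    simp only [sphDensity]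
    by_cases h1 : √(a ^ 2 + y ^ 2) ∈ Iic (1 : ℝ)
    · rw [indicator_of_mem h1, indicator_of_mem h1, ← ENNReal.ofReal_mul (pow_nonneg hy'.le _),
        ← ENNReal.ofReal_mul (pow_nonneg hy'.le _), ← ENNReal.ofReal_mul
          (mul_nonneg (by positivity) (ballVolume_pos _).le),
        ← ENNReal.ofReal_mul (sphConst_pos hm).le, sphConst]
      congr 1
      field_simp
    · rw [indicator_of_notMem h1, indicator_of_notMem h1, mul_zero, mul_zero, mul_zero]
  rw [hslice, ← lintegral_const_mul' _ _ ENNReal.ofReal_ne_top,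
    ← lintegral_indicator measurableSet_Ioc]
  -- Leaving out the null set `a = α` reconciles the closed half-space with the half-open interval.
  have hne : ∀ᵐ a : ℝ, a ≠ α := by simp [ae_iff]
  refine lintegral_congr_ae ?_
  filter_upwards [hne] with a ha
  by_cases haα : α < a
  · have h1 : ∀ r, F a r = sphDensity m r := fun r => indicator_of_mem (mem_Ici.2 haα.le) _
    simp only [h1]
    rw [hinner a (hα.trans_lt haα)]
    by_cases ha1 : a ≤ 1
    · rw [indicator_of_mem (show a ∈ Ioc α 1 from ⟨haα, ha1⟩)]
    · rw [indicator_of_notMem (fun h => ha1 h.2), Ioc_eq_empty (fun h => ha1 h.le)]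
      simp
  · have h1 : ∀ r, F a r = 0 := fun r =>
      indicator_of_notMem (fun h => haα (lt_of_le_of_ne h (Ne.symm ha))) _
    simp only [h1, lintegral_zero]
    rw [indicator_of_notMem (fun h => haα h.1)]

/-- The substitution removes the singularity that the integrand has at `r = a` for `m = 1`: what
remains is bounded by `(a ^ m)⁻¹` and vanishes for `y > 1`. -/
lemma lintegral_sphIntegrand_lt_top (hm : 0 < m) {a : ℝ} (ha : 0 < a) :
    ∫⁻ r in Ioc a 1, ENNReal.ofReal (sphIntegrand (m + 1) a r) < ⊤ := by
  rw [lintegral_sphIntegrand hm ha]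
  have hle : ∀ y ∈ Ioi (0 : ℝ), ENNReal.ofReal (y ^ (m - 1)) *
      (Iic 1).indicator (fun r => ENNReal.ofReal ((r ^ m)⁻¹)) (√(a ^ 2 + y ^ 2)) ≤
      (Ioc (0 : ℝ) 1).indicator (fun _ => ENNReal.ofReal ((a ^ m)⁻¹)) y := by
    intro y hy
    have hy' : (0 : ℝ) < y := hy
    by_cases h1 : √(a ^ 2 + y ^ 2) ∈ Iic (1 : ℝ)
    · have h2 : a ^ 2 + y ^ 2 ≤ 1 := by
        have := (Real.sqrt_le_iff.1 (show √(a ^ 2 + y ^ 2) ≤ 1 from h1)).2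
        linarith
      have hy1 : y ≤ 1 := by nlinarith
      have har : a ≤ √(a ^ 2 + y ^ 2) := Real.le_sqrt_of_sq_le (by nlinarith)
      rw [indicator_of_mem h1, indicator_of_mem (show y ∈ Ioc (0 : ℝ) 1 from ⟨hy', hy1⟩),
        ← ENNReal.ofReal_mul (by positivity)]
      refine ENNReal.ofReal_le_ofReal ?_
      calc y ^ (m - 1) * ((√(a ^ 2 + y ^ 2)) ^ m)⁻¹ ≤ 1 * (a ^ m)⁻¹ := by
            gcongr
            exact pow_le_one₀ hy'.le hy1
        _ = _ := one_mul _
    · rw [indicator_of_notMem h1, mul_zero]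
      exact zero_le
  refine lt_of_le_of_lt (setLIntegral_mono' measurableSet_Ioi hle) ?_
  refine lt_of_le_of_lt (setLIntegral_le_lintegral _ _) ?_
  rw [lintegral_indicator_const measurableSet_Ioc]
  exact ENNReal.mul_lt_top ENNReal.ofReal_lt_top (by simp)

lemma measurable_sphIntegrand (d : ℕ) : Measurable (Function.uncurry (sphIntegrand d)) := by
  unfold Function.uncurry sphIntegrand
  fun_prop

lemma sphIntegrand_nonneg (d : ℕ) {a r : ℝ} (ha : 0 ≤ a) (hr : a ≤ r) :
    0 ≤ sphIntegrand d a r :=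
  mul_nonneg (Real.rpow_nonneg (ha.trans hr) _) (Real.rpow_nonneg (by nlinarith) _)

theorem integrableOn_sphIntegrand (hm : 0 < m) {a : ℝ} (ha : 0 < a) :
    IntegrableOn (sphIntegrand (m + 1) a) (Ioc a 1) := by
  refine ⟨((measurable_sphIntegrand (m + 1)).of_uncurry_left).aestronglyMeasurable, ?_⟩
  rw [hasFiniteIntegral_iff_ofReal ((ae_restrict_iff' measurableSet_Ioc).2
    (ae_of_all _ fun r hr => sphIntegrand_nonneg _ ha.le hr.1.le))]
  exact lintegral_sphIntegrand_lt_top hm ha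

lemma ofReal_integral_sphIntegrand (hm : 0 < m) {a : ℝ} (ha : a ∈ Ioc (0 : ℝ) 1) :
    ENNReal.ofReal (∫ r in a..1, sphIntegrand (m + 1) a r) =
      ∫⁻ r in Ioc a 1, ENNReal.ofReal (sphIntegrand (m + 1) a r) := by
  rw [intervalIntegral.integral_of_le ha.2, ofReal_integral_eq_lintegral_ofReal
    (integrableOn_sphIntegrand hm ha.1)]
  exact (ae_restrict_iff' measurableSet_Ioc).2
    (ae_of_all _ fun r hr => sphIntegrand_nonneg _ ha.1.le hr.1.le)

lemma integral_sphIntegrand_nonneg {a : ℝ} (ha : a ∈ Ioc (0 : ℝ) 1) :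
    0 ≤ ∫ r in a..1, sphIntegrand (m + 1) a r :=
  intervalIntegral.integral_nonneg ha.2 fun _ hr => sphIntegrand_nonneg _ ha.1.le hr.1

theorem integrableOn_integral_sphIntegrand (hm : 0 < m) :
    IntegrableOn (fun a => ∫ r in a..1, sphIntegrand (m + 1) a r) (Ioc 0 1) := by
  have hJ : Measurable fun a : ℝ =>
      ∫⁻ r in Ioc a 1, ENNReal.ofReal (sphIntegrand (m + 1) a r) := by
    have h1 : ∀ a : ℝ, ∫⁻ r in Ioc a 1, ENNReal.ofReal (sphIntegrand (m + 1) a r) =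
        ∫⁻ r, {p : ℝ × ℝ | p.1 < p.2 ∧ p.2 ≤ 1}.indicator
          (fun p => ENNReal.ofReal (sphIntegrand (m + 1) p.1 p.2)) (a, r) := fun a => by
      rw [← lintegral_indicator measurableSet_Ioc]
      rfl
    simp only [h1]
    refine Measurable.lintegral_prod_right' (Measurable.indicator ?_ ?_)
    · exact (measurable_sphIntegrand (m + 1)).ennreal_ofReal
    · exact (measurableSet_lt measurable_fst measurable_snd).inter
        (measurableSet_le measurable_snd measurable_const)
  refine ⟨?_, ?_⟩
  · refine (hJ.ennreal_toReal.aestronglyMeasurable).congr ((ae_restrict_iff' measurableSet_Ioc).2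
      (ae_of_all _ fun a ha => ?_))
    simp only
    rw [← ofReal_integral_sphIntegrand hm ha,
      ENNReal.toReal_ofReal (integral_sphIntegrand_nonneg ha)]
  · rw [hasFiniteIntegral_iff_ofReal ((ae_restrict_iff' measurableSet_Ioc).2
      (ae_of_all _ fun a ha => integral_sphIntegrand_nonneg ha)),
      setLIntegral_congr_fun measurableSet_Ioc fun a ha => ofReal_integral_sphIntegrand hm ha]
    -- Up to the positive factor `sphConst m`, the integral is the mass of the half-space at level
    -- `0` under a probability measure, hence finite.
    have := isProbabilityMeasure_sphMeasure m
    have h := sphMeasure_halfSpace hm le_rfl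
    refine lt_top_iff_ne_top.2 fun htop => ?_
    rw [htop, ENNReal.mul_top (ENNReal.ofReal_pos.2 (sphConst_pos hm)).ne'] at h
    exact measure_ne_top _ _ h

theorem sphMeasure_real_halfSpace (hm : 0 < m) {α : ℝ} (hα : α ∈ Icc (0 : ℝ) 1) :
    (sphMeasure m).real {u | α ≤ u 0} =
      sphConst m * ∫ a in α..1, ∫ r in a..1, sphIntegrand (m + 1) a r := by
  have hsub : Ioc α 1 ⊆ Ioc 0 1 := Ioc_subset_Ioc_left hα.1
  rw [measureReal_def, sphMeasure_halfSpace hm hα.1, ENNReal.toReal_mul,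
    ENNReal.toReal_ofReal (sphConst_pos hm).le, intervalIntegral.integral_of_le hα.2,
    ← setLIntegral_congr_fun measurableSet_Ioc
      fun a ha => ofReal_integral_sphIntegrand hm (hsub ha),
    integral_eq_lintegral_of_nonneg_ae]
  · exact (ae_restrict_iff' measurableSet_Ioc).2
      (ae_of_all _ fun a ha => integral_sphIntegrand_nonneg (hsub ha))
  · exact ((integrableOn_integral_sphIntegrand hm).mono_set hsub).aestronglyMeasurable

end Radial

/-! ### Half-space masses in the first coordinate. -/

section Main

variable {m n : ℕ} {μ : Measure (E (m + 1))}

lemma inner_first (u : E (m + 1)) : ⟪(EuclideanSpace.single 0 1 : E (m + 1)), u⟫ = u 0 := by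
  simp [EuclideanSpace.inner_single_left]

lemma OrthogonalInvariant.measure_halfSpace_eq_first (hinv : OrthogonalInvariant μ)
    {v : E (m + 1)} (hv : ‖v‖ = 1) (c : ℝ) : μ {u | c ≤ ⟪v, u⟫} = μ {u | c ≤ u 0} := by
  rw [hinv.measure_halfSpace_eq (z := EuclideanSpace.single 0 1) (by simpa using hv)]
  simp only [inner_first]

lemma measure_singleton_zero (hac : μ ≪ volume) : μ {0} = 0 :=
  hac (measure_singleton 0)

/-- The unit sphere is a null set and a coordinate is bounded by the norm, so the additional
constraints hold almost everywhere. -/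
lemma measureReal_cap_eq (hac : μ ≪ volume) (hsupp : μ.support = Metric.closedBall 0 1) (α : ℝ) :
    μ.real (Metric.ball 0 1 ∩ {u | α ≤ u 0 ∧ u 0 ≤ 1}) = μ.real {u | α ≤ u 0} := by
  have hs : ∀ᵐ u ∂μ, u ∉ Metric.sphere (0 : E (m + 1)) 1 :=
    measure_eq_zero_iff_ae_notMem.1 (hac (Measure.addHaar_sphere volume 0 1))
  refine measureReal_congr ?_
  filter_upwards [ae_norm_le_one hsupp.le, hs] with u hu hu'
  have hlt : ‖u‖ < 1 := lt_of_le_of_ne hu (by simpa using hu')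
  refine propext ⟨fun h => h.2.1, fun h => ⟨by simpa using hlt, h, ?_⟩⟩
  exact (le_abs_self _).trans ((PiLp.norm_apply_le u 0).trans hu)

theorem IsSphericalUniform.measureReal_halfSpace (hac : μ ≪ volume) (hμ : IsSphericalUniform μ)
    (hm : 0 < m) {α : ℝ} (hα : α ∈ Icc (0 : ℝ) 1) :
    μ.real {u | α ≤ u 0} =
      sphConst m * ∫ a in α..1, ∫ r in a..1, sphIntegrand (m + 1) a r := by
  have := hμ.1
  have := isProbabilityMeasure_sphMeasure m
  have h := measure_halfSpace_eq_of_map_norm_eq hμ.2.1 (orthogonalInvariant_sphMeasure m)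
    (measure_singleton_zero hac) (hμ.map_norm.trans (map_norm_sphMeasure m).symm)
    (v := EuclideanSpace.single 0 1) (by simp) α
  simp only [inner_first] at h
  rw [← sphMeasure_real_halfSpace hm hα, measureReal_def, h, measureReal_def]

/-- Reflection gives the two half-lines equal mass, and together they form the complement of the
ball of radius `α`. -/
theorem IsSphericalUniform.measureReal_halfLine {μ : Measure (E 1)} (hac : μ ≪ volume)
    (hμ : IsSphericalUniform μ) {α : ℝ} (hα : α ∈ Icc (0 : ℝ) 1) :
    μ.real {u | α ≤ u 0} = (1 - α) / 2 := by
  have := hμ.1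
  have hnorm : ∀ u : E 1, ‖u‖ = |u 0| := fun u => by
    rw [EuclideanSpace.norm_eq]; simp [Real.sqrt_sq_eq_abs]
  have hmeas : MeasurableSet {u : E 1 | α ≤ u 0} :=
    measurableSet_le measurable_const (by fun_prop)
  have hmeas' : MeasurableSet {u : E 1 | α ≤ -u 0} :=
    measurableSet_le measurable_const (by fun_prop)
  have hneg : μ.real {u | α ≤ -u 0} = μ.real {u | α ≤ u 0} := by
    rw [measureReal_def, measureReal_def, ← (hμ.2.1.measurePreserving
      (LinearIsometryEquiv.neg ℝ)).measure_preimage hmeas.nullMeasurableSet]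
    rfl
  have hunion : {u : E 1 | α ≤ u 0} ∪ {u | α ≤ -u 0} = (Metric.ball 0 α)ᶜ := by
    ext u
    simp only [mem_union, mem_ofPred_eq, mem_compl_iff, mem_ball_zero_iff, hnorm, not_lt, le_abs]
  -- The half-lines meet only for `α = 0`, and then in the origin.
  have hdisj : AEDisjoint μ {u : E 1 | α ≤ u 0} {u | α ≤ -u 0} := by
    refine measure_mono_null (fun u hu => ?_) (measure_singleton_zero hac)
    have h1 : α ≤ u 0 := hu.1
    have h2 : α ≤ -u 0 := hu.2
    have h3 : u 0 = 0 := by linarith [hα.1]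
    rw [mem_singleton_iff, ← norm_eq_zero, hnorm, h3, abs_zero]
  have h := measureReal_union₀ (μ := μ) hmeas'.nullMeasurableSet hdisj
  rw [hunion, probReal_compl_eq_one_sub measurableSet_ball, measureReal_def, hμ.2.2 α hα,
    ENNReal.toReal_ofReal hα.1, hneg] at h
  linarith

end Main

end SemiDiscreteOT

/-! ### The breakdown point formulas. -/

open SemiDiscreteOT in
theorem corollary2 {d n : ℕ} (hd : 0 < d) (hn : 0 < n)
    (μ : Measure (E d)) [IsProbabilityMeasure μ]
    (hac : μ ≪ volume) (hinv : OrthogonalInvariant μ)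
    (hsupp : μ.support = Metric.closedBall 0 1)
    (x : Fin n → E d) (hx : Function.Injective x) :
    (∀ α ∈ Set.Icc (0 : ℝ) 1, ∀ v : E d, ‖v‖ = 1 →
      empiricalBreakdownPoint μ x (α • v) =
        (modCeil (n * μ.real (Metric.ball 0 1 ∩ {u : E d | α ≤ u ⟨0, hd⟩ ∧ u ⟨0, hd⟩ ≤ 1})) : ℝ)
          / n) ∧
    (IsSphericalUniform μ →
      (2 ≤ d →
        (∀ t ∈ Set.Ioc (0 : ℝ) 1, IntervalIntegrable (sphIntegrand d t) volume t 1) ∧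
        IntervalIntegrable (fun t => ∫ r in t..1, sphIntegrand d t r) volume 0 1 ∧
        ∀ α ∈ Set.Icc (0 : ℝ) 1, ∀ v : E d, ‖v‖ = 1 →
          empiricalBreakdownPoint μ x (α • v) =
            (modCeil (n * Real.Gamma ((d : ℝ) / 2) /
                (Real.sqrt Real.pi * Real.Gamma (((d : ℝ) - 1) / 2)) *
                  ∫ t in α..1, ∫ r in t..1, sphIntegrand d t r) : ℝ) / n) ∧
      (d = 1 →
        ∀ α ∈ Set.Icc (0 : ℝ) 1, ∀ v : E d, ‖v‖ = 1 →
          empiricalBreakdownPoint μ x (α • v) = (modCeil (n * ((1 - α) / 2)) : ℝ) / n)) ∧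
    (μ = uniformBall d →
      ∀ α ∈ Set.Icc (0 : ℝ) 1, ∀ v : E d, ‖v‖ = 1 →
        empiricalBreakdownPoint μ x (α • v) =
          (modCeil (n * Real.Gamma (((d : ℝ) + 2) / 2) /
              (Real.sqrt Real.pi * Real.Gamma (((d : ℝ) + 1) / 2)) *
                ∫ t in α..1, (1 - t ^ 2) ^ (((d : ℝ) - 1) / 2)) : ℝ) / n) := by
  obtain ⟨m, rfl⟩ := Nat.exists_eq_succ_of_ne_zero hd.ne'
  have key : ∀ α ∈ Set.Icc (0 : ℝ) 1, ∀ v : E (m + 1), ‖v‖ = 1 →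
      empiricalBreakdownPoint μ x (α • v) = (modCeil (n * μ.real {u | α ≤ u 0}) : ℝ) / n := by
    intro α hα v hv
    rw [empiricalBreakdownPoint_eq hn hac hinv hsupp hx hv hα, measureReal_def,
      hinv.measure_halfSpace_eq_first hv, measureReal_def]
  refine ⟨fun α hα v hv => ?_, fun hμ => ⟨fun hd2 => ?_, fun hd1 α hα v hv => ?_⟩,
    fun hμ α hα v hv => ?_⟩
  · rw [key α hα v hv, ← measureReal_cap_eq hac hsupp α]
    rfl
  · have hm : 0 < m := by omega
    refine ⟨fun t ht => ?_, ?_, fun α hα v hv => ?_⟩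
    · rw [intervalIntegrable_iff_integrableOn_Ioc_of_le ht.2]
      exact integrableOn_sphIntegrand hm ht.1
    · rw [intervalIntegrable_iff_integrableOn_Ioc_of_le zero_le_one]
      exact integrableOn_integral_sphIntegrand hm
    · rw [key α hα v hv, hμ.measureReal_halfSpace hac hm hα, sphConst_eq hm, ← mul_assoc,
        mul_div_assoc]
  · obtain rfl : m = 0 := by omega
    rw [key α hα v hv, hμ.measureReal_halfLine hac hα]
  · subst hμ
    rw [key α hα v hv, uniformBall_halfSpace hα, ballVolume_div, ← mul_assoc, mul_div_assoc]
    simp only [Nat.succ_eq_add_one, Nat.cast_add, Nat.cast_one, add_sub_cancel_right]
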